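/- For $p\in\mathbb{C}$ with $|p|<1$ and $z\in\mathbb{C}\setminus\{0\}$ let $\theta(z;p)=\prod_{j\ge 0}(1-zp^j)(1-p^{j+1}/z)$. For $a,q\in\mathbb{C}\setminus\{0\}$ and integers $n\ge 0$ let $(a;q,p)_n=\prod_{j=0}^{n-1}\theta(aq^j;p)$ and $(a;q,p)_{-n}=1/(aq^{-n};q,p)_n$. A pair of complex sequences $(\alpha_n)_{n\ge 0},(\beta_n)_{n\ge 0}$ is an elliptic WP Bailey pair with parameters $(a,k;q,p)$ if for all $n\ge 0$ $$\beta_n=\sum_{r=0}^n\frac{(k/a;q,p)_{n-r}}{(q;q,p)_{n-r}}\frac{(k;q,p)_{n+r}}{(aq;q,p)_{n+r}}\,\alpha_r,$$ $$\alpha_n=\frac{\theta(aq^{2n};p)}{\theta(a;p)}\sum_{r=0}^n\frac{\theta(kq^{2r};p)}{\theta(k;p)}\frac{(a/k;q,p)_{n-r}}{(q;q,p)_{n-r}}\frac{(a;q,p)_{n+r}}{(kq;q,p)_{n+r}}\Bigl(\frac ka\Bigr)^{n-r}\beta_r .$$ For a positive integer $i$, a pair of complex sequences $(A^{(i)}_n)_{n\ge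 0},(B^{(i)}_n)_{n\ge 0}$ is a bibasic elliptic WP Bailey pair with parameters $(a,k;q,p)$ if for all $n\ge 0$ $$B^{(i)}_n=\sum_{r=0}^n\frac{(k/a;q,p)_{n-ir}}{(q^i;q^i,p)_{n-r}}\frac{(k;q,p)_{n+ir}}{(aq^i;q^i,p)_{n+r}}\,A^{(i)}_r .$$ **Theorem.** Let $a,k,m,q\in\mathbb{C}\setminus\{0\}$ and $|p|<1$ be such that no denominator below or in the definitions above (with the parameters used here) vanishes, i.e. for all integers $j\ge 0$ none of $$q^{2j+2},\quad aq^{2j},\quad kq^{2j},\quad mq^{j},\quad \frac{m}{a}q^{-j-1},\quad \frac{k}{m}q^{j},\quad \frac{ak}{m^2}q^{2j+1},\quad \frac{m^2}{a}q^{2j+1}$$ is a zero of $\theta(\,\cdot\,;p)$. Let $(A^{(2)},B^{(2)})$ be a bibasic elliptic WP Bailey pair with $i=2$ and parameters $(a,m;q,p)$, and define, for $n\ge 0$, $$\alpha_n=\frac{(m^2q/k;q^2,p)_n}{(akq/m^2;q^2,p)_n}\,q^{n^2}\Bigl(-\frac{ak}{m^2}\Bigr)^n A^{(2)}_n,$$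 $$\begin{aligned}\beta_n=\frac{(m^2q/a;q^2,p)_n}{(akq/m^2;q^2,p)_n}\sum_{r=0}^n&\frac{\theta(mq^{3r};p)}{\theta(m;p)}\frac{(aq/m;q,p)_r}{(m^2q/a;q^2,p)_r}\frac{(m^2q/k;q^2,p)_r}{(k/m;q,p)_r}\\&\times\frac{(k/m;q,p)_{2n-r}}{(q^2;q^2,p)_{n-r}}\frac{(k;q^2,p)_{n+r}}{(mq;q,p)_{2n+r}}\,q^{\binom r2}\Bigl(\frac km\Bigr)^rB^{(2)}_r.\end{aligned}$$ Then $(\alpha,\beta)$ is an elliptic WP Bailey pair with parameters $(a,k;q^2,p)$. -/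

import Mathlib

noncomputable section

/-- The modified Jacobi theta function `θ(z; p) = ∏_{j ≥ 0} (1 - z p^j) (1 - p^(j+1) / z)`,
used for `‖p‖ < 1` and `z ≠ 0`, where the product converges absolutely. -/
def modTheta (z p : ℂ) : ℂ :=
  ∏' j : ℕ, (1 - z * p ^ j) * (1 - p ^ (j + 1) / z)

/-- The elliptic shifted factorial `(a; q, p)_n` for an integer `n`:
`∏_{j=0}^{n-1} θ(a q^j; p)` for `n ≥ 0`, and `(a; q, p)_{-n} = 1 / (a q^{-n}; q, p)_n`, that is
`1 / ∏_{j=1}^{n} θ(a q^{-j}; p)`, for a negative index `-n`. -/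
def ellFac (a q p : ℂ) : ℤ → ℂ
  | Int.ofNat n => ∏ j ∈ Finset.range n, modTheta (a * q ^ j) p
  | Int.negSucc n => (∏ j ∈ Finset.range (n + 1), modTheta (a / q ^ (j + 1)) p)⁻¹

/-- `(α, β)` is an elliptic WP Bailey pair with parameters `(a, k; q, p)`: the two mutually inverse
relations expressing `β` through `α` and `α` through `β` hold. -/
def IsEllipticWPBaileyPair (a k q p : ℂ) (α β : ℕ → ℂ) : Prop :=
  (∀ n : ℕ, β n = ∑ r ∈ Finset.range (n + 1),
      ellFac (k / a) q p ((n : ℤ) - r) / ellFac q q p ((n : ℤ) - r) *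
        (ellFac k q p ((n : ℤ) + r) / ellFac (a * q) q p ((n : ℤ) + r)) * α r) ∧
  (∀ n : ℕ, α n = modTheta (a * q ^ (2 * n)) p / modTheta a p *
      ∑ r ∈ Finset.range (n + 1),
        modTheta (k * q ^ (2 * r)) p / modTheta k p *
          (ellFac (a / k) q p ((n : ℤ) - r) / ellFac q q p ((n : ℤ) - r)) *
          (ellFac a q p ((n : ℤ) + r) / ellFac (k * q) q p ((n : ℤ) + r)) *
          (k / a) ^ (n - r) * β r)

/-- `(A, B)` is a bibasic elliptic WP Bailey pair of order `i ≥ 1` with parameters `(a, k; q, p)`.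
For `i ≥ 2` the index `n - i r` may be negative. -/
def IsBibasicEllipticWPBaileyPair (i : ℕ) (a k q p : ℂ) (A B : ℕ → ℂ) : Prop :=
  ∀ n : ℕ, B n = ∑ r ∈ Finset.range (n + 1),
    ellFac (k / a) q p ((n : ℤ) - i * r) / ellFac (q ^ i) (q ^ i) p ((n : ℤ) - r) *
      (ellFac k q p ((n : ℤ) + i * r) / ellFac (a * q ^ i) (q ^ i) p ((n : ℤ) + r)) * A r

end

/-! Insert the bibasic relation for `B` into the definition of `β` and interchange the sums. With r
= s + t and N = n - s, the coefficient of A_s is, up to a factor free of t, a cubic theta sum of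
length N with parameters (aq^{4s}, kq^{4s}, mq^{3s}). Its closed form (`cubicSum`, applied in
`bibasic_sum`) is the kernel of a WP Bailey pair in base q² times the factor that turns A_s into
α_s. This is the first relation. The second follows because the two triangular matrices of a WP
Bailey pair are mutually inverse (`bailey_inversion`), which reduces to a telescoping
very-well-poised sum.

The cubic sum is proved by interpolation in a. With q = s² and a = xm/s, every term and the
right-hand side are constants times products of N factors θ(Yx)θ(Y/x). By `exists_modTheta_bracket`
such a factor is a linear form in a vector (o(x), e(x)), so both sides are binary forms of degree N,
and agreement at N + 1 pairwise independent vectors suffices. The nodes are a = m, where only the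
term t = 0 survives, and a = m²q^{2J-1} for 1 ≤ J ≤ N, where the terms t < J vanish and the rest is
a cubic sum of length N - J, known by induction. Independence of the nodes needs θ(m²q^{2j+1}) ≠ 0;
this is removed at the end by continuity in m.

All theta identities rest on the bracket, which comes from the Jacobi triple product and a parity
splitting of a product of two theta series. The Weierstrass three-term relation, which drives the
telescoping, is the Plücker relation of these brackets. -/

open Filter Topology

/-! ### Finite Jacobi triple product -/

/-- The reciprocal of `(p; p)_m`, extended by `0` to negative `m`. -/
noncomputable def recipQFac (p : ℂ) (m : ℤ) : ℂ :=
  if m < 0 then 0 else (∏ i ∈ Finset.range m.toNat, (1 - p ^ (i + 1)))⁻¹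

lemma recipQFac_natCast (p : ℂ) (n : ℕ) :
    recipQFac p n = (∏ i ∈ Finset.range n, (1 - p ^ (i + 1)))⁻¹ := by
  simp [recipQFac]

lemma recipQFac_of_neg (p : ℂ) {m : ℤ} (hm : m < 0) : recipQFac p m = 0 := by
  simp [recipQFac, hm]

lemma one_sub_pow_succ_ne_zero {p : ℂ} (hp : ‖p‖ < 1) (n : ℕ) : 1 - p ^ (n + 1) ≠ 0 := by
  intro h
  have h1 : ‖p ^ (n + 1)‖ = 1 := by rw [← sub_eq_zero.mp h, norm_one]
  rw [norm_pow] at h1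
  exact (pow_lt_one₀ (norm_nonneg p) hp n.succ_ne_zero).ne h1

/-- The value 0 at negative indices makes the recurrence valid on all of ℤ: at m = 0 the factor 1 -
p^0 vanishes. -/
lemma recipQFac_sub_one {p : ℂ} (hp : ‖p‖ < 1) (m : ℤ) :
    recipQFac p (m - 1) = (1 - p ^ m) * recipQFac p m := by
  rcases lt_trichotomy m 0 with h | rfl | h
  · rw [recipQFac_of_neg p h, recipQFac_of_neg p (by omega), mul_zero]
  · simp [recipQFac]
  · obtain ⟨n, rfl⟩ : ∃ n : ℕ, m = n + 1 := ⟨(m - 1).toNat, by omega⟩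
    have := one_sub_pow_succ_ne_zero hp n
    rw [add_sub_cancel_right, recipQFac_natCast, ← Nat.cast_succ, recipQFac_natCast,
      Finset.prod_range_succ, zpow_natCast, mul_inv, mul_left_comm, mul_inv_cancel₀ this, mul_one]

/-- The finite form of the Jacobi triple product identity. -/
lemma hasSum_finite_triple_product {s : ℂ} (hs0 : s ≠ 0) (hs : ‖s ^ 2‖ < 1) {z : ℂ} (hz : z ≠ 0)
    (n : ℕ) :
    HasSum (fun k : ℤ => (-z / s) ^ k * s ^ (k ^ 2) *
        ((∏ i ∈ Finset.range (2 * n), (1 - (s ^ 2) ^ (i + 1))) *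
          (recipQFac (s ^ 2) (n - k) * recipQFac (s ^ 2) (n + k))))
      (∏ j ∈ Finset.range n, (1 - z * (s ^ 2) ^ j) * (1 - (s ^ 2) ^ (j + 1) / z)) := by
  induction n with
  | zero =>
    have := hasSum_single (f := fun k : ℤ => (-z / s) ^ k * s ^ (k ^ 2) *
        ((∏ i ∈ Finset.range (2 * 0), (1 - (s ^ 2) ^ (i + 1))) *
          (recipQFac (s ^ 2) ((0 : ℕ) - k) * recipQFac (s ^ 2) ((0 : ℕ) + k)))) 0 (by
      intro k hk
      rcases lt_or_gt_of_ne hk with h | h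
      · rw [recipQFac_of_neg _ (m := (0 : ℕ) + k) (by simpa using h)]; simp
      · rw [recipQFac_of_neg _ (m := (0 : ℕ) - k) (by simpa using h)]; simp)
    simpa [recipQFac] using this
  | succ n ih =>
    -- Multiplying by (1 - zp^n)(1 - p^{n+1}/z) = 1 + p^{2n+1} - zp^n - p^{n+1}/z, with p = s²,
    -- shifts the summation index by 0 and ±1; it remains to compare coefficients.
    have h1 := (Equiv.subRight (1 : ℤ)).hasSum_iff.mpr ih
    have h2 := (Equiv.addRight (1 : ℤ)).hasSum_iff.mpr ih
    have h3 := ((ih.mul_left (1 + (s ^ 2) ^ (2 * n + 1))).sub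
      (h1.mul_left (z * (s ^ 2) ^ n))).sub (h2.mul_left ((s ^ 2) ^ (n + 1) / z))
    have hP : ∏ j ∈ Finset.range (n + 1), (1 - z * (s ^ 2) ^ j) * (1 - (s ^ 2) ^ (j + 1) / z) =
        (1 + (s ^ 2) ^ (2 * n + 1)) *
            ∏ j ∈ Finset.range n, (1 - z * (s ^ 2) ^ j) * (1 - (s ^ 2) ^ (j + 1) / z) -
          z * (s ^ 2) ^ n *
            ∏ j ∈ Finset.range n, (1 - z * (s ^ 2) ^ j) * (1 - (s ^ 2) ^ (j + 1) / z) -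
          (s ^ 2) ^ (n + 1) / z *
            ∏ j ∈ Finset.range n, (1 - z * (s ^ 2) ^ j) * (1 - (s ^ 2) ^ (j + 1) / z) := by
      rw [Finset.prod_range_succ]
      field_simp
      ring
    rw [hP]
    refine (congrArg (fun f => HasSum f _) (funext fun k => ?_)).mpr h3
    · simp only [Function.comp, Equiv.subRight_apply, Equiv.coe_addRight]
      have e1 : (s ^ 2) ^ ((n : ℤ) + 1 - k) = s ^ (2 * n + 2) * (s ^ (2 * k))⁻¹ := by
        rw [← zpow_natCast, ← zpow_natCast, ← zpow_mul, ← zpow_neg, ← zpow_add₀ hs0]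
        congr 1; push_cast; ring
      have e2 : (s ^ 2) ^ ((n : ℤ) + 1 + k) = s ^ (2 * n + 2) * s ^ (2 * k) := by
        rw [← zpow_natCast, ← zpow_natCast, ← zpow_mul, ← zpow_add₀ hs0]
        congr 1; push_cast; ring
      have e3 : (s ^ 2) ^ ((n : ℤ) - k) = s ^ (2 * n) * (s ^ (2 * k))⁻¹ := by
        rw [← zpow_natCast, ← zpow_natCast, ← zpow_mul, ← zpow_neg, ← zpow_add₀ hs0]
        congr 1; push_cast; ring
      have e4 : (s ^ 2) ^ ((n : ℤ) + k) = s ^ (2 * n) * s ^ (2 * k) := by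
        rw [← zpow_natCast, ← zpow_natCast, ← zpow_mul, ← zpow_add₀ hs0]
        congr 1; push_cast; ring
      have a1 : recipQFac (s ^ 2) (n - k) =
          (1 - s ^ (2 * n + 2) * (s ^ (2 * k))⁻¹) * recipQFac (s ^ 2) ((n + 1 : ℕ) - k) := by
        have := recipQFac_sub_one hs (n + 1 - k)
        rw [e1] at this
        rw [Nat.cast_succ, ← this]; congr 1; ring
      have a2 : recipQFac (s ^ 2) (n + k) =
          (1 - s ^ (2 * n + 2) * s ^ (2 * k)) * recipQFac (s ^ 2) ((n + 1 : ℕ) + k) := by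
        have := recipQFac_sub_one hs (n + 1 + k)
        rw [e2] at this
        rw [Nat.cast_succ, ← this]; congr 1; ring
      have a3 : recipQFac (s ^ 2) (n - (k + 1)) = (1 - s ^ (2 * n) * (s ^ (2 * k))⁻¹) *
          recipQFac (s ^ 2) (n - k) := by
        have := recipQFac_sub_one hs (n - k)
        rw [e3] at this
        rw [← this]; congr 1; ring
      have a4 : recipQFac (s ^ 2) (n + (k - 1)) = (1 - s ^ (2 * n) * s ^ (2 * k)) *
          recipQFac (s ^ 2) (n + k) := by
        have := recipQFac_sub_one hs (n + k)
        rw [e4] at this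
        rw [← this]; congr 1; ring
      have a5 : recipQFac (s ^ 2) (n - (k - 1)) = recipQFac (s ^ 2) ((n + 1 : ℕ) - k) := by
        congr 1; push_cast; ring
      have a6 : recipQFac (s ^ 2) (n + (k + 1)) = recipQFac (s ^ 2) ((n + 1 : ℕ) + k) := by
        congr 1; push_cast; ring
      have hzs : -z / s ≠ 0 := div_ne_zero (neg_ne_zero.mpr hz) hs0
      have b1 : s ^ ((k - 1) ^ 2) = s ^ (k ^ 2) * (s ^ (2 * k))⁻¹ * s := by
        rw [← zpow_neg, ← zpow_add₀ hs0, ← zpow_add_one₀ hs0]; congr 1; ring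
      have b2 : s ^ ((k + 1) ^ 2) = s ^ (k ^ 2) * s ^ (2 * k) * s := by
        rw [← zpow_add₀ hs0, ← zpow_add_one₀ hs0]; congr 1; ring
      rw [a5, a6, a3, a4, a1, a2, b1, b2, zpow_sub_one₀ hzs, zpow_add_one₀ hzs,
        show 2 * (n + 1) = 2 * n + 1 + 1 by ring, Finset.prod_range_succ, Finset.prod_range_succ]
      have hk : s ^ (2 * k) ≠ 0 := zpow_ne_zero _ hs0
      generalize s ^ (2 * k) = K at *
      generalize s ^ (k ^ 2) = K2
      generalize recipQFac (s ^ 2) ((n + 1 : ℕ) + k) = R1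
      generalize recipQFac (s ^ 2) ((n + 1 : ℕ) - k) = R2
      generalize (-z / s) ^ k = Z
      generalize ∏ i ∈ Finset.range (2 * n), (1 - (s ^ 2) ^ (i + 1)) = P
      field_simp
      ring

/-! ### Convergence, zeros and the infinite triple product -/

/-- These are the terms of the two-variable Jacobi theta function at log c / (2πi) and τ = log s /
(πi), and Im τ = -log‖s‖ / π > 0. -/
lemma summable_zpow_mul_zpow_sq {c s : ℂ} (hc : c ≠ 0) (hs0 : s ≠ 0) (hs : ‖s‖ < 1) :
    Summable (fun n : ℤ => c ^ n * s ^ (n ^ 2)) := by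
  have hpi : (Real.pi : ℂ) ≠ 0 := by exact_mod_cast Real.pi_ne_zero
  have h := (summable_jacobiTheta₂_term_iff (Complex.log c / (2 * Real.pi * Complex.I))
    (Complex.log s / (Real.pi * Complex.I))).mpr (by
      have : Complex.log s / (Real.pi * Complex.I) = ((Real.pi⁻¹ : ℝ) : ℂ) *
          (-(Complex.log s * Complex.I)) := by
        push_cast
        field_simp
        rw [Complex.I_sq]; ring
      rw [this, Complex.im_ofReal_mul, Complex.neg_im, Complex.mul_I_im, Complex.log_re]
      have h1 := Real.log_neg (norm_pos_iff.mpr hs0) hs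
      have h2 := inv_pos.mpr Real.pi_pos
      nlinarith)
  refine h.congr fun n => ?_
  rw [jacobiTheta₂_term, Complex.exp_add]
  congr 1
  · rw [show 2 * Real.pi * Complex.I * n * (Complex.log c / (2 * Real.pi * Complex.I)) =
      n * Complex.log c by field_simp, Complex.exp_int_mul, Complex.exp_log hc]
  · rw [show Real.pi * Complex.I * n ^ 2 * (Complex.log s / (Real.pi * Complex.I)) =
      ((n ^ 2 : ℤ) : ℂ) * Complex.log s by push_cast; field_simp, Complex.exp_int_mul,
      Complex.exp_log hs0]

lemma tendsto_prod_one_sub_pow {p : ℂ} (hp : ‖p‖ < 1) :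
    ∃ L : ℂ, L ≠ 0 ∧
      Tendsto (fun n => ∏ i ∈ Finset.range n, (1 - p ^ (i + 1))) atTop (𝓝 L) := by
  have hsum : Summable fun i : ℕ => ‖-p ^ (i + 1)‖ := by
    simpa [norm_pow] using
      (summable_nat_add_iff 1).mpr (summable_geometric_of_lt_one (norm_nonneg p) hp)
  refine ⟨∏' i : ℕ, (1 + -p ^ (i + 1)), tprod_one_add_ne_zero_of_summable (fun i => ?_) hsum, ?_⟩
  · rw [← sub_eq_add_neg]; exact one_sub_pow_succ_ne_zero hp i
  · simpa [sub_eq_add_neg] using (multipliable_one_add_of_summable hsum).hasProd.tendsto_prod_nat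

lemma summable_norm_modTheta_factor {p : ℂ} (hp : ‖p‖ < 1) (z : ℂ) :
    Summable fun j : ℕ => ‖(1 - z * p ^ j) * (1 - p ^ (j + 1) / z) - 1‖ := by
  have hg : Summable fun j : ℕ => ‖p‖ ^ j := summable_geometric_of_lt_one (norm_nonneg p) hp
  refine Summable.of_nonneg_of_le (fun _ => norm_nonneg _) (fun j => ?_)
    (hg.mul_left (‖z‖ + ‖p / z‖ + ‖z * (p / z)‖))
  have : (1 - z * p ^ j) * (1 - p ^ (j + 1) / z) - 1 =
      -(z * p ^ j) + -(p / z * p ^ j) + z * (p / z) * p ^ j * p ^ j := by ring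
  rw [this]
  have hpj : ‖p ^ j‖ ≤ 1 := by rw [norm_pow]; exact pow_le_one₀ (norm_nonneg _) hp.le
  refine (norm_add₃_le).trans ?_
  simp only [norm_neg]
  rw [add_mul, add_mul, norm_mul z, norm_mul (p / z), norm_mul (z * (p / z) * p ^ j),
    norm_mul (z * (p / z)), norm_pow]
  rw [norm_pow] at hpj
  have h1 : 0 ≤ ‖z * (p / z)‖ * ‖p‖ ^ j := by positivity
  nlinarith

lemma tendsto_modTheta {p : ℂ} (hp : ‖p‖ < 1) (z : ℂ) :
    Tendsto (fun n => ∏ j ∈ Finset.range n, (1 - z * p ^ j) * (1 - p ^ (j + 1) / z)) atTop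
      (𝓝 (modTheta z p)) := by
  have h := (multipliable_one_add_of_summable
    (summable_norm_modTheta_factor hp z)).hasProd.tendsto_prod_nat
  simpa [modTheta] using h

lemma exists_of_modTheta_eq_zero {p : ℂ} (hp : ‖p‖ < 1) {z : ℂ} (h : modTheta z p = 0) :
    ∃ j : ℕ, (1 - z * p ^ j) * (1 - p ^ (j + 1) / z) = 0 := by
  by_contra! hne
  refine tprod_one_add_ne_zero_of_summable (fun j => ?_) (summable_norm_modTheta_factor hp z) ?_
  · simpa using hne j
  · simpa [modTheta] using h

/-- An absolutely convergent product vanishes only if a factor does, so zeros lie among p^{-j} and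
p^{j+1}. Countability is what the density argument in m needs. -/
lemma countable_modTheta_eq_zero {p : ℂ} (hp : ‖p‖ < 1) :
    {z : ℂ | z ≠ 0 ∧ modTheta z p = 0}.Countable := by
  refine ((Set.countable_range fun j : ℕ => (p ^ j)⁻¹).union
    (Set.countable_range fun j : ℕ => p ^ (j + 1))).mono ?_
  rintro z ⟨hz, h⟩
  obtain ⟨j, hj⟩ := exists_of_modTheta_eq_zero hp h
  rcases mul_eq_zero.mp hj with h1 | h1
  · left
    exact ⟨j, inv_eq_of_mul_eq_one_left (sub_eq_zero.mp h1).symm⟩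
  · right
    have h2 := (eq_div_iff hz).mp (sub_eq_zero.mp h1)
    exact ⟨j, by simpa using h2.symm⟩

/-- The Jacobi triple product identity. -/
lemma exists_modTheta_eq_tsum {s : ℂ} (hs0 : s ≠ 0) (hs : ‖s‖ < 1) :
    ∃ C : ℂ, ∀ z : ℂ, z ≠ 0 →
      modTheta z (s ^ 2) = C * ∑' n : ℤ, (-z / s) ^ n * s ^ (n ^ 2) := by
  have hp : ‖s ^ 2‖ < 1 := by
    rw [norm_pow]; exact pow_lt_one₀ (norm_nonneg _) hs two_ne_zero
  obtain ⟨L, hL0, hL⟩ := tendsto_prod_one_sub_pow hp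
  have hr : Tendsto (fun n : ℕ => recipQFac (s ^ 2) n) atTop (𝓝 L⁻¹) := by
    simpa only [recipQFac_natCast] using hL.inv₀ hL0
  have htoNat : Tendsto Int.toNat atTop atTop :=
    tendsto_atTop.mpr fun b => (eventually_ge_atTop (b : ℤ)).mono fun a ha => by omega
  have hrZ : Tendsto (recipQFac (s ^ 2)) atTop (𝓝 L⁻¹) := by
    refine (hr.comp htoNat).congr' ?_
    filter_upwards [eventually_ge_atTop 0] with m hm
    simp [Int.toNat_of_nonneg hm]
  obtain ⟨K₁, hK₁⟩ := hL.norm.bddAbove_range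
  obtain ⟨K₂, hK₂⟩ := hr.norm.bddAbove_range
  have hK₁' (n : ℕ) : ‖∏ i ∈ Finset.range n, (1 - (s ^ 2) ^ (i + 1))‖ ≤ K₁ := hK₁ ⟨n, rfl⟩
  have hK₂' (m : ℤ) : ‖recipQFac (s ^ 2) m‖ ≤ K₂ := by
    rcases lt_or_ge m 0 with h | h
    · rw [recipQFac_of_neg _ h, norm_zero]
      exact (norm_nonneg _).trans (hK₂ ⟨0, rfl⟩)
    · have := hK₂ ⟨m.toNat, rfl⟩
      simpa [Int.toNat_of_nonneg h] using this
  refine ⟨L⁻¹, fun z hz => ?_⟩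
  have hc : -z / s ≠ 0 := div_ne_zero (neg_ne_zero.mpr hz) hs0
  -- Dominated convergence: the weight (p;p)_{2n} / ((p;p)_{n-k} (p;p)_{n+k}) is bounded uniformly
  -- in n and k and tends to L · L⁻² for each k.
  have hlim := tendsto_tsum_of_dominated_convergence (𝓕 := atTop)
    (f := fun (n : ℕ) (k : ℤ) => (-z / s) ^ k * s ^ (k ^ 2) *
        ((∏ i ∈ Finset.range (2 * n), (1 - (s ^ 2) ^ (i + 1))) *
          (recipQFac (s ^ 2) (n - k) * recipQFac (s ^ 2) (n + k))))
    (g := fun k => (-z / s) ^ k * s ^ (k ^ 2) * (L * (L⁻¹ * L⁻¹)))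
    (bound := fun k => ‖(-z / s) ^ k * s ^ (k ^ 2)‖ * (K₁ * (K₂ * K₂)))
    ((summable_zpow_mul_zpow_sq hc hs0 hs).norm.mul_right _) (fun k => by
      refine Tendsto.const_mul _ (Tendsto.mul ?_ (Tendsto.mul ?_ ?_))
      · exact hL.comp (tendsto_atTop.mpr fun b => (eventually_ge_atTop b).mono fun a ha => by omega)
      · exact hrZ.comp (tendsto_atTop.mpr fun b =>
          (eventually_ge_atTop (b + k).toNat).mono fun a ha => by omega)
      · exact hrZ.comp (tendsto_atTop.mpr fun b =>
          (eventually_ge_atTop (b - k).toNat).mono fun a ha => by omega))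
    (Eventually.of_forall fun n k => by
      rw [norm_mul, norm_mul (∏ i ∈ _, _), norm_mul (recipQFac _ _)]
      have h0 : 0 ≤ K₂ := (norm_nonneg _).trans (hK₂' 0)
      have h1 : 0 ≤ K₁ := (norm_nonneg _).trans (hK₁' 0)
      gcongr
      exacts [hK₁' _, hK₂' _, hK₂' _])
  have huniq := tendsto_nhds_unique hlim ((tendsto_modTheta hp z).congr fun n =>
    ((hasSum_finite_triple_product hs0 hp hz n).tsum_eq).symm)
  rw [← huniq, tsum_mul_right]
  field_simp

/-! ### Theta series and their products -/

/-- The theta series `∑ cⁿ s^(n²)` over the integers. -/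
noncomputable def thetaSeries (s c : ℂ) : ℂ := ∑' n : ℤ, c ^ n * s ^ (n ^ 2)

/-- Pairs of integers of equal, respectively of different, parity, in terms of half their sum and
difference. -/
lemma bijective_parity_split : Function.Bijective (Sum.elim
    (fun w : ℤ × ℤ => (w.1 + w.2, w.1 - w.2)) (fun w : ℤ × ℤ => (w.1 + w.2 + 1, w.1 - w.2))) := by
  constructor
  · rintro (⟨a, b⟩ | ⟨a, b⟩) (⟨c, d⟩ | ⟨c, d⟩) h <;>
      simp only [Sum.elim_inl, Sum.elim_inr, Prod.mk.injEq] at h <;>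
      simp only [Sum.inl.injEq, Sum.inr.injEq, Prod.mk.injEq, reduceCtorEq] <;> omega
  · rintro ⟨m, n⟩
    rcases Int.even_or_odd' (m + n) with ⟨k, hk | hk⟩
    · exact ⟨Sum.inl (k, k - n), by simp only [Sum.elim_inl, Prod.mk.injEq]; omega⟩
    · exact ⟨Sum.inr (k, k - n), by simp only [Sum.elim_inr, Prod.mk.injEq]; omega⟩

/-- The double sum over exponents (i, j) splits by the parity of i + j. In the coordinates u, v of
`bijective_parity_split` the quadratic exponent i² + j² has no mixed term, so each half factors. -/
lemma thetaSeries_mul_thetaSeries {s g y : ℂ} (hs0 : s ≠ 0) (hs : ‖s‖ < 1) (hg : g ≠ 0)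
    (hy : y ≠ 0) :
    thetaSeries s (g * y) * thetaSeries s (g / y) =
      thetaSeries (s ^ 2) (g ^ 2) * thetaSeries (s ^ 2) (y ^ 2) +
      g * y * s * (thetaSeries (s ^ 2) (g ^ 2 * s ^ 2) * thetaSeries (s ^ 2) (y ^ 2 * s ^ 2)) := by
  have hs2 : ‖s ^ 2‖ < 1 := by
    rw [norm_pow]; exact pow_lt_one₀ (norm_nonneg _) hs two_ne_zero
  have hs20 : s ^ 2 ≠ 0 := pow_ne_zero _ hs0
  have S1 := (summable_zpow_mul_zpow_sq (mul_ne_zero hg hy) hs0 hs).norm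
  have S2 := (summable_zpow_mul_zpow_sq (div_ne_zero hg hy) hs0 hs).norm
  have S3 := (summable_zpow_mul_zpow_sq (pow_ne_zero 2 hg) hs20 hs2).norm
  have S4 := (summable_zpow_mul_zpow_sq (pow_ne_zero 2 hy) hs20 hs2).norm
  have S5 := (summable_zpow_mul_zpow_sq (mul_ne_zero (pow_ne_zero 2 hg) hs20) hs20 hs2).norm
  have S6 := (summable_zpow_mul_zpow_sq (mul_ne_zero (pow_ne_zero 2 hy) hs20) hs20 hs2).norm
  simp only [thetaSeries]
  rw [tsum_mul_tsum_of_summable_norm S1 S2, tsum_mul_tsum_of_summable_norm S3 S4,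
    tsum_mul_tsum_of_summable_norm S5 S6, ← tsum_mul_left,
    ← (Equiv.ofBijective _ bijective_parity_split).tsum_eq]
  have hsum := ((Equiv.ofBijective _ bijective_parity_split).summable_iff).mpr
    (summable_mul_of_summable_norm S1 S2)
  refine (Summable.tsum_sum (hsum.comp_injective Sum.inl_injective)
    (hsum.comp_injective Sum.inr_injective)).trans ?_
  have sq_zpow (c : ℂ) (n : ℤ) : (c ^ 2) ^ n = c ^ (2 * n) := by
    rw [zpow_mul]; rfl
  congr 1
  · refine tsum_congr fun w => ?_
    obtain ⟨u, v⟩ := w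
    simp only [Function.comp, Equiv.ofBijective_apply, Sum.elim_inl, sq_zpow, mul_zpow, div_zpow]
    have e1 : g ^ (2 * u) = g ^ (u + v) * g ^ (u - v) := by rw [← zpow_add₀ hg]; congr 1; ring
    have e2 : y ^ (2 * v) = y ^ (u + v) / y ^ (u - v) := by rw [← zpow_sub₀ hy]; congr 1; ring
    have e3 : s ^ (2 * u ^ 2) * s ^ (2 * v ^ 2) = s ^ ((u + v) ^ 2) * s ^ ((u - v) ^ 2) := by
      rw [← zpow_add₀ hs0, ← zpow_add₀ hs0]; congr 1; ring
    rw [e1, e2]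
    linear_combination (-(g ^ (u + v) * g ^ (u - v) * (y ^ (u + v) / y ^ (u - v)))) * e3
  · refine tsum_congr fun w => ?_
    obtain ⟨u, v⟩ := w
    simp only [Function.comp, Equiv.ofBijective_apply, Sum.elim_inr, sq_zpow, mul_zpow, div_zpow]
    have e1 : g ^ (u + v + 1) * g ^ (u - v) = g * g ^ (2 * u) := by
      rw [← zpow_add₀ hg, ← zpow_one_add₀ hg]; congr 1; ring
    have e2 : y ^ (u + v + 1) / y ^ (u - v) = y * y ^ (2 * v) := by
      rw [← zpow_sub₀ hy, ← zpow_one_add₀ hy]; congr 1; ring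
    have e3 : s ^ ((u + v + 1) ^ 2) * s ^ ((u - v) ^ 2) =
        s * (s ^ (2 * u) * s ^ (2 * v) * s ^ (2 * u ^ 2) * s ^ (2 * v ^ 2)) := by
      simp only [← zpow_add₀ hs0, ← zpow_one_add₀ hs0]; congr 1; ring
    calc _ = (g ^ (u + v + 1) * g ^ (u - v)) * (y ^ (u + v + 1) / y ^ (u - v)) *
          (s ^ ((u + v + 1) ^ 2) * s ^ ((u - v) ^ 2)) := by ring
      _ = _ := by rw [e1, e2, e3]; ring

lemma thetaSeries_eq_mul {s c : ℂ} (hs0 : s ≠ 0) (hc : c ≠ 0) :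
    thetaSeries s c = c * s * thetaSeries s (c * s ^ 2) := by
  simp only [thetaSeries]
  rw [← tsum_mul_left, ← (Equiv.addRight (1 : ℤ)).tsum_eq]
  refine tsum_congr fun n => ?_
  rw [Equiv.coe_addRight, mul_zpow, zpow_add_one₀ hc,
    show (s ^ 2) ^ n = s ^ (2 * n) by rw [zpow_mul]; rfl,
    show (n + 1) ^ 2 = 1 + 2 * n + n ^ 2 by ring, zpow_add₀ hs0, zpow_add₀ hs0, zpow_one]
  ring

lemma thetaSeries_inv (s c : ℂ) : thetaSeries s c⁻¹ = thetaSeries s c := by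
  simp only [thetaSeries]
  rw [← (Equiv.neg ℤ).tsum_eq]
  refine tsum_congr fun n => ?_
  simp

/-! ### Bracket, inversion and continuity of the theta function -/

lemma modTheta_zero_right {z : ℂ} : modTheta z 0 = 1 - z := by
  rw [modTheta, tprod_eq_mulSingle 0]
  · simp
  · intro j hj; simp [hj]

lemma exists_sq_eq_of_norm_lt_one {p : ℂ} (hp : ‖p‖ < 1) (hp0 : p ≠ 0) :
    ∃ s : ℂ, s ≠ 0 ∧ ‖s‖ < 1 ∧ s ^ 2 = p := by
  obtain ⟨s, hs⟩ := IsAlgClosed.exists_pow_nat_eq p two_pos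
  refine ⟨s, ?_, ?_, hs⟩
  · rintro rfl; exact hp0 (by simpa using hs.symm)
  · rw [← hs, norm_pow] at hp
    exact (pow_lt_one_iff_of_nonneg (norm_nonneg _) two_ne_zero).mp hp

lemma exists_modTheta_eq_thetaSeries {p : ℂ} (hp : ‖p‖ < 1) (hp0 : p ≠ 0) :
    ∃ s C : ℂ, s ≠ 0 ∧ ‖s‖ < 1 ∧ ∀ z : ℂ, z ≠ 0 → modTheta z p = C * thetaSeries s (-z / s) := by
  obtain ⟨s, hs0, hs, rfl⟩ := exists_sq_eq_of_norm_lt_one hp hp0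
  obtain ⟨C, hC⟩ := exists_modTheta_eq_tsum hs0 hs
  exact ⟨s, C, hs0, hs, hC⟩

/-- The product `θ(xy) θ(x/y)` is, up to the factor `x`, a nondegenerate alternating form of two
vectors depending on `x` and on `y`. -/
lemma exists_modTheta_bracket {p : ℂ} (hp : ‖p‖ < 1) :
    ∃ o e : ℂ → ℂ, ∀ x y : ℂ, x ≠ 0 → y ≠ 0 →
      modTheta (x * y) p * modTheta (x / y) p = x * (o x * e y - e x * o y) := by
  by_cases hp0 : p = 0
  · subst hp0
    refine ⟨fun x => x + 1 / x, fun _ => 1, fun x y hx hy => ?_⟩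
    simp only [modTheta_zero_right]
    field_simp
    ring
  · obtain ⟨s, C, hs0, hs, hC⟩ := exists_modTheta_eq_thetaSeries hp hp0
    have hs20 : s ^ 2 ≠ 0 := pow_ne_zero _ hs0
    refine ⟨fun x => C * (x * thetaSeries (s ^ 2) (x ^ 2 * s ^ 2)),
      fun x => C * thetaSeries (s ^ 2) (x ^ 2), fun x y hx hy => ?_⟩
    have h := thetaSeries_mul_thetaSeries hs0 hs (div_ne_zero (neg_ne_zero.mpr hx) hs0) hy
    -- Quasi-periodicity moves the argument x²/s² to x²s², which gives both products the same pair
    -- of functions and makes the form alternating.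
    have h1 := thetaSeries_eq_mul hs20 (div_ne_zero (pow_ne_zero 2 hx) hs20)
    rw [show x ^ 2 / s ^ 2 * (s ^ 2) ^ 2 = x ^ 2 * s ^ 2 by field_simp,
      show x ^ 2 / s ^ 2 * s ^ 2 = x ^ 2 by field_simp] at h1
    rw [show (-x / s) ^ 2 = x ^ 2 / s ^ 2 by ring, h1,
      show x ^ 2 / s ^ 2 * s ^ 2 = x ^ 2 by field_simp,
      show -x / s * y * s = -(x * y) by field_simp] at h
    rw [hC _ (mul_ne_zero hx hy), hC _ (div_ne_zero hx hy),
      show -(x * y) / s = -x / s * y by ring, show -(x / y) / s = -x / s / y by ring]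
    linear_combination C ^ 2 * h

lemma modTheta_inv {p : ℂ} (hp : ‖p‖ < 1) {z : ℂ} (hz : z ≠ 0) :
    modTheta z⁻¹ p = -z⁻¹ * modTheta z p := by
  by_cases hp0 : p = 0
  · subst hp0
    simp only [modTheta_zero_right]
    field_simp
    ring
  · obtain ⟨s, C, hs0, hs, hC⟩ := exists_modTheta_eq_thetaSeries hp hp0
    rw [hC _ hz, hC _ (inv_ne_zero hz), ← thetaSeries_inv s (-z / s),
      thetaSeries_eq_mul hs0 (div_ne_zero (neg_ne_zero.mpr (inv_ne_zero hz)) hs0),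
      show -z⁻¹ / s * s ^ 2 = (-z / s)⁻¹ by field_simp]
    field_simp

lemma modTheta_one {p : ℂ} (hp : ‖p‖ < 1) : modTheta 1 p = 0 := by
  have h := modTheta_inv hp one_ne_zero
  rw [inv_one] at h
  linear_combination h / 2

/-- Weierstrass test on the annulus r < ‖z‖ < R: ‖z‖^n is at most R^n for n ≥ 0 and at most r^n for
n ≤ 0, hence always at most the sum. -/
lemma continuousAt_thetaSeries {s c : ℂ} (hs0 : s ≠ 0) (hs : ‖s‖ < 1) (hc : c ≠ 0) :
    ContinuousAt (thetaSeries s) c := by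
  have hr : 0 < ‖c‖ / 2 := half_pos (norm_pos_iff.mpr hc)
  set r := ‖c‖ / 2
  have hR : 0 < ‖c‖ + 1 := by positivity
  set R := ‖c‖ + 1
  have hS (t : ℝ) (ht : 0 < t) := (summable_zpow_mul_zpow_sq
    (c := (t : ℂ)) (by exact_mod_cast ht.ne') hs0 hs).norm
  have hU : {z : ℂ | r < ‖z‖ ∧ ‖z‖ < R} ∈ 𝓝 c := by
    have : IsOpen {z : ℂ | r < ‖z‖ ∧ ‖z‖ < R} :=
      (isOpen_lt continuous_const continuous_norm).inter (isOpen_lt continuous_norm continuous_const)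
    refine this.mem_nhds ⟨half_lt_self (norm_pos_iff.mpr hc), lt_add_one _⟩
  refine ContinuousOn.continuousAt (s := {z : ℂ | r < ‖z‖ ∧ ‖z‖ < R}) ?_ hU
  refine continuousOn_tsum (fun n => ?_) ((hS R hR).add (hS r hr)) (fun n z hz => ?_)
  · refine ContinuousOn.mul (fun z hz => ?_) continuousOn_const
    exact (continuousAt_zpow₀ z n (Or.inl (norm_pos_iff.mp (hr.trans hz.1)))).continuousWithinAt
  · simp only [norm_mul, norm_zpow, Complex.norm_real, Real.norm_of_nonneg hR.le,
      Real.norm_of_nonneg hr.le]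
    rw [← add_mul]
    refine mul_le_mul_of_nonneg_right ?_ (by positivity)
    have hz0 : 0 < ‖z‖ := hr.trans hz.1
    rcases le_total 0 n with hn | hn
    · have h1 := zpow_le_zpow_left₀ hn hz0.le hz.2.le
      have h2 : 0 < r ^ n := by positivity
      linarith
    · have h1 : ‖z‖ ^ n ≤ r ^ n := by
        obtain ⟨k, rfl⟩ : ∃ k : ℕ, n = -k := ⟨n.natAbs, by omega⟩
        simp only [zpow_neg, zpow_natCast]
        exact inv_anti₀ (by positivity) (pow_le_pow_left₀ hr.le hz.1.le k)
      have h2 : 0 < R ^ n := by positivity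
      linarith

lemma continuousAt_modTheta {p : ℂ} (hp : ‖p‖ < 1) {z : ℂ} (hz : z ≠ 0) :
    ContinuousAt (fun z => modTheta z p) z := by
  by_cases hp0 : p = 0
  · subst hp0
    simp only [modTheta_zero_right]
    fun_prop
  · obtain ⟨s, C, hs0, hs, hC⟩ := exists_modTheta_eq_thetaSeries hp hp0
    have h : ContinuousAt (fun z => C * thetaSeries s (-z / s)) z :=
      continuousAt_const.mul (ContinuousAt.comp (f := fun z : ℂ => -z / s)
        (continuousAt_thetaSeries hs0 hs (div_ne_zero (neg_ne_zero.mpr hz) hs0)) (by fun_prop))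
    refine h.congr ?_
    filter_upwards [isOpen_ne.mem_nhds hz] with w hw
    exact (hC w hw).symm

/-! ### Interpolation of binary forms -/

/-- A form of degree `N` in two variables that vanishes at `N + 1` pairwise independent vectors is
zero; the form is given as a linear combination of products of linear forms. -/
lemma sum_prod_linear_eq_zero {ι : Type*} (T : Finset ι) (N : ℕ) (c : ι → ℂ) (a b : ι → ℕ → ℂ)
    (u w : ℕ → ℂ) (hind : ∀ i j, i < j → j ≤ N → u i * w j - w i * u j ≠ 0)
    (hzero : ∀ j ≤ N, ∑ i ∈ T, c i * ∏ l ∈ Finset.range N, (a i l * u j + b i l * w j) = 0)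
    (x y : ℂ) : ∑ i ∈ T, c i * ∏ l ∈ Finset.range N, (a i l * x + b i l * y) = 0 := by
  rcases Nat.eq_zero_or_pos N with rfl | hN
  · simpa using hzero 0 le_rfl
  have hind' : ∀ i j, i ≤ N → j ≤ N → i ≠ j → u i * w j - w i * u j ≠ 0 := by
    intro i j hi hj hij
    rcases lt_or_gt_of_ne hij with h | h
    · exact hind i j h hj
    · intro h0
      exact hind j i h hi (by linear_combination -h0)
  have hscale (r x' y' : ℂ) : ∑ i ∈ T, c i * ∏ l ∈ Finset.range N,
      (a i l * (r * x') + b i l * (r * y')) =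
      r ^ N * ∑ i ∈ T, c i * ∏ l ∈ Finset.range N, (a i l * x' + b i l * y') := by
    rw [Finset.mul_sum]
    refine Finset.sum_congr rfl fun i _ => ?_
    have : ∏ l ∈ Finset.range N, (a i l * (r * x') + b i l * (r * y')) =
        r ^ N * ∏ l ∈ Finset.range N, (a i l * x' + b i l * y') := by
      rw [← Finset.card_range N, ← Finset.prod_const, Finset.card_range, ← Finset.prod_mul_distrib]
      exact Finset.prod_congr rfl fun l _ => by ring
    rw [this]; ring
  by_cases hex : ∃ j ≤ N, x * w j - y * u j = 0
  · obtain ⟨j, hj, h⟩ := hex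
    -- For N ≥ 1 each node has an independent partner, so it is not the zero vector.
    have hne : u j ≠ 0 ∨ w j ≠ 0 := by
      by_contra! h0
      obtain ⟨i, hi, hij⟩ : ∃ i ≤ N, i ≠ j := by
        rcases Nat.eq_zero_or_pos j with rfl | hj0
        · exact ⟨N, le_rfl, by omega⟩
        · exact ⟨0, by omega, by omega⟩
      exact hind' i j hi hj hij (by rw [h0.1, h0.2]; ring)
    obtain ⟨r, hx, hy⟩ : ∃ r, x = r * u j ∧ y = r * w j := by
      rcases hne with h0 | h0
      · exact ⟨x / u j, by field_simp, by field_simp; linear_combination -h⟩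
      · exact ⟨y / w j, by field_simp; linear_combination h, by field_simp⟩
    rw [hx, hy, hscale, hzero j hj, mul_zero]
  · push Not at hex
    set D := x * w 0 - y * u 0 with hD
    have hD0 : D ≠ 0 := hex 0 (Nat.zero_le _)
    -- P is the form restricted to the line X·(x, y) + (u₀, w₀). Its coefficient at X^N is the form
    -- at (x, y).
    set P : Polynomial ℂ := ∑ i ∈ T, Polynomial.C (c i) * ∏ l ∈ Finset.range N,
      (Polynomial.C (a i l * x + b i l * y) * Polynomial.X +
        Polynomial.C (a i l * u 0 + b i l * w 0)) with hP
    have hdegl (i : ι) (l : ℕ) : (Polynomial.C (a i l * x + b i l * y) * Polynomial.X +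
        Polynomial.C (a i l * u 0 + b i l * w 0)).natDegree ≤ 1 := Polynomial.natDegree_linear_le
    have hdeg : P.natDegree ≤ N := by
      refine Polynomial.natDegree_sum_le_of_forall_le _ _ fun i _ => ?_
      refine (Polynomial.natDegree_C_mul_le _ _).trans ((Polynomial.natDegree_prod_le _ _).trans ?_)
      refine (Finset.sum_le_card_nsmul _ _ 1 fun l _ => hdegl i l).trans (by simp)
    -- At X = τ_j the point on the line is D / (x w_j - y u_j) times the node (u_j, w_j), so P has N
    -- + 1 distinct roots.
    set τ : Fin (N + 1) → ℂ := fun j => (u j * w 0 - w j * u 0) / (x * w j - y * u j) with hτ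
    have hxj (j : Fin (N + 1)) : x * w j - y * u j ≠ 0 := hex j (Nat.lt_succ_iff.mp j.2)
    have hinj : Function.Injective τ := by
      intro i j hij
      by_contra hne
      simp only [hτ] at hij
      rw [div_eq_div_iff (hxj i) (hxj j)] at hij
      refine mul_ne_zero (hind' i j (Nat.lt_succ_iff.mp i.2) (Nat.lt_succ_iff.mp j.2)
        (fun h => hne (Fin.ext h))) hD0 ?_
      rw [hD]; linear_combination hij
    have heval (j : Fin (N + 1)) : P.eval (τ j) = 0 := by
      have h1 : P.eval (τ j) = ∑ i ∈ T, c i * ∏ l ∈ Finset.range N,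
          (a i l * (D / (x * w j - y * u j) * u j) + b i l * (D / (x * w j - y * u j) * w j)) := by
        rw [hP, Polynomial.eval_finsetSum]
        refine Finset.sum_congr rfl fun i _ => ?_
        rw [Polynomial.eval_mul, Polynomial.eval_C, Polynomial.eval_prod]
        congr 1
        refine Finset.prod_congr rfl fun l _ => ?_
        simp only [Polynomial.eval_add, Polynomial.eval_mul, Polynomial.eval_C, Polynomial.eval_X,
          hτ, hD]
        have := hxj j
        field_simp
        ring
      rw [h1, hscale, hzero j (Nat.lt_succ_iff.mp j.2), mul_zero]
    have hP0 : P = 0 := Polynomial.eq_zero_of_natDegree_lt_card_of_eval_eq_zero P hinj heval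
      (by simpa using Nat.lt_succ_iff.mpr hdeg)
    have hcoeff : P.coeff N = ∑ i ∈ T, c i * ∏ l ∈ Finset.range N, (a i l * x + b i l * y) := by
      rw [hP, Polynomial.finsetSum_coeff]
      refine Finset.sum_congr rfl fun i _ => ?_
      rw [Polynomial.coeff_C_mul]
      congr 1
      have h := Polynomial.coeff_prod_of_natDegree_le (Finset.range N) (fun l =>
        Polynomial.C (a i l * x + b i l * y) * Polynomial.X +
        Polynomial.C (a i l * u 0 + b i l * w 0)) 1 (fun l _ => hdegl i l)
      rw [Finset.card_range, mul_one] at h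
      rw [h]
      refine Finset.prod_congr rfl fun l _ => ?_
      simp
    rw [← hcoeff, hP0, Polynomial.coeff_zero]

/-- A linear combination of products of `N` factors `θ(xy) θ(y/x)` that vanishes for `N + 1`
inequivalent values of `x` vanishes for all `x`. -/
lemma sum_prod_modTheta_eq_zero {p : ℂ} (hp : ‖p‖ < 1) {ι : Type*} (T : Finset ι) (N : ℕ)
    (c : ι → ℂ) (Y : ι → ℕ → ℂ) (hY : ∀ i l, Y i l ≠ 0) (X : ℕ → ℂ) (hX : ∀ j, X j ≠ 0)
    (hind : ∀ i j, i < j → j ≤ N → modTheta (X j * X i) p * modTheta (X j / X i) p ≠ 0)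
    (hzero : ∀ j ≤ N, ∑ i ∈ T, c i * ∏ l ∈ Finset.range N,
      (modTheta (Y i l * X j) p * modTheta (Y i l / X j) p) = 0) {x : ℂ} (hx : x ≠ 0) :
    ∑ i ∈ T, c i * ∏ l ∈ Finset.range N,
      (modTheta (Y i l * x) p * modTheta (Y i l / x) p) = 0 := by
  obtain ⟨o, e, hoe⟩ := exists_modTheta_bracket hp
  have hform (i : ι) (l : ℕ) (x : ℂ) (hx : x ≠ 0) :
      modTheta (Y i l * x) p * modTheta (Y i l / x) p =
        Y i l * o (Y i l) * e x + -(Y i l * e (Y i l)) * o x := by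
    rw [hoe _ _ (hY i l) hx]; ring
  simp only [hform _ _ _ hx]
  refine sum_prod_linear_eq_zero T N c _ _ (fun j => e (X j)) (fun j => o (X j)) ?_ ?_ _ _
  · intro i j hij hj h0
    refine hind i j hij hj ?_
    rw [hoe _ _ (hX j) (hX i)]
    linear_combination X j * h0
  · intro j hj
    simpa only [hform _ _ _ (hX j)] using hzero j hj

/-! ### Theta shifted factorials -/

/-- The theta shifted factorial `∏_{j < n} θ(x b^j; p)`. -/
noncomputable def thetaFac (p x b : ℂ) (n : ℕ) : ℂ := ∏ j ∈ Finset.range n, modTheta (x * b ^ j) p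

lemma ellFac_natCast (x b p : ℂ) (n : ℕ) : ellFac x b p n = thetaFac p x b n := rfl

@[simp] lemma thetaFac_zero (p x b : ℂ) : thetaFac p x b 0 = 1 := by simp [thetaFac]

lemma thetaFac_succ (p x b : ℂ) (n : ℕ) :
    thetaFac p x b (n + 1) = thetaFac p x b n * modTheta (x * b ^ n) p := by
  simp [thetaFac, Finset.prod_range_succ]

lemma thetaFac_add (p x b : ℂ) (m n : ℕ) :
    thetaFac p x b (m + n) = thetaFac p x b m * thetaFac p (x * b ^ m) b n := by
  simp only [thetaFac, Finset.prod_range_add, pow_add, mul_assoc]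

lemma thetaFac_one (p x b : ℂ) : thetaFac p x b 1 = modTheta x p := by simp [thetaFac]

lemma thetaFac_succ' (p x b : ℂ) (n : ℕ) :
    thetaFac p x b (n + 1) = modTheta x p * thetaFac p (x * b) b n := by
  rw [add_comm, thetaFac_add, thetaFac_one, pow_one]

lemma thetaFac_two_mul (p x b : ℂ) (n : ℕ) :
    thetaFac p x b (2 * n) = thetaFac p x (b ^ 2) n * thetaFac p (x * b) (b ^ 2) n := by
  induction n with
  | zero => simp
  | succ n ih =>
    rw [show 2 * (n + 1) = 2 * n + 1 + 1 by ring, thetaFac_succ, thetaFac_succ, ih, thetaFac_succ,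
      thetaFac_succ, ← pow_mul, pow_succ, show x * b * b ^ (2 * n) = x * (b ^ (2 * n) * b) by ring]
    ring_nf

lemma thetaFac_ne_zero {p x b : ℂ} {n : ℕ} (h : ∀ j < n, modTheta (x * b ^ j) p ≠ 0) :
    thetaFac p x b n ≠ 0 :=
  Finset.prod_ne_zero_iff.mpr fun j hj => h j (Finset.mem_range.mp hj)

lemma thetaFac_eq_zero_of_one {p b : ℂ} (hp : ‖p‖ < 1) {x : ℂ} {n j : ℕ} (hj : j < n)
    (h : x * b ^ j = 1) : thetaFac p x b n = 0 :=
  Finset.prod_eq_zero (Finset.mem_range.mpr hj) (by rw [h, modTheta_one hp])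

lemma prod_neg_mul_pow (x b : ℂ) (n : ℕ) :
    ∏ j ∈ Finset.range n, (-(x * b ^ j)) = (-x) ^ n * b ^ (n.choose 2) := by
  induction n with
  | zero => simp
  | succ n ih =>
    rw [Finset.prod_range_succ, ih, Nat.choose_succ_succ' n 1, Nat.choose_one_right]
    ring

/-- Reversal of a theta shifted factorial: here `y = b^(1-n) / x`. -/
lemma thetaFac_reverse {p : ℂ} (hp : ‖p‖ < 1) {x y b : ℂ} (hx : x ≠ 0) (hb : b ≠ 0) {n : ℕ}
    (h : y * x * b ^ n = b) :
    thetaFac p y b n * ((-x) ^ n * b ^ (n.choose 2)) = thetaFac p x b n := by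
  rw [← prod_neg_mul_pow, ← Finset.prod_range_reflect (fun j => -(x * b ^ j)) n, thetaFac, thetaFac,
    ← Finset.prod_range_reflect (fun j => modTheta (x * b ^ j) p) n, ← Finset.prod_mul_distrib]
  refine Finset.prod_congr rfl fun j hj => ?_
  obtain ⟨d, rfl⟩ : ∃ d, n = j + d + 1 := ⟨n - 1 - j, by have := Finset.mem_range.mp hj; omega⟩
  rw [show j + d + 1 - 1 - j = d by omega]
  have hz : x * b ^ d ≠ 0 := mul_ne_zero hx (pow_ne_zero _ hb)
  have h1 : y * b ^ j = (x * b ^ d)⁻¹ := by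
    refine eq_inv_of_mul_eq_one_left (mul_right_cancel₀ hb ?_)
    linear_combination h
  rw [h1, modTheta_inv hp hz]
  field_simp

attribute [irreducible] thetaFac

lemma choose_two_add (m n : ℕ) : (m + n).choose 2 = m.choose 2 + n.choose 2 + m * n := by
  induction n with
  | zero => simp
  | succ n ih =>
    rw [← add_assoc, Nat.choose_succ_succ' (m + n) 1, Nat.choose_succ_succ' n 1, ih,
      Nat.choose_one_right, Nat.choose_one_right]
    ring

lemma add_two_mul_choose_two (n : ℕ) : n + 2 * n.choose 2 = n * n := by
  induction n with
  | zero => simp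
  | succ n ih =>
    rw [Nat.choose_succ_succ' n 1, Nat.choose_one_right]
    nlinarith

/-! ### The cubic sum: factorization and the node a = m -/

/-- The coefficients of the cubic theta hypergeometric sum of length `t + d`. -/
noncomputable def cubicCoeff (p k m q : ℂ) (t d : ℕ) : ℂ :=
  modTheta (m * q ^ (3 * t)) p * thetaFac p (m ^ 2 * q / k) (q ^ 2) t *
    thetaFac p (k * q ^ t / m) q (2 * d) * thetaFac p (k * q ^ (2 * (t + d))) (q ^ 2) t *
    q ^ (t.choose 2) * (k / m) ^ t /
  (thetaFac p (q ^ 2) (q ^ 2) d * thetaFac p (q ^ 2) (q ^ 2) t *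
    thetaFac p (m * q ^ t) q (2 * (t + d) + 1))

/-- The basis of theta functions in `a` in which the cubic sum is an expansion. -/
noncomputable def cubicBasis (p a m q : ℂ) (t d : ℕ) : ℂ :=
  thetaFac p (a * q / m) q t * thetaFac p (m / a) q t *
    (thetaFac p (m ^ 2 * q ^ (2 * t + 1) / a) (q ^ 2) d *
      thetaFac p (a * q ^ (2 * t + 2)) (q ^ 2) d)

/-- The cubic theta hypergeometric summation formula of length `N`. -/
def CubicSum (p a k m q : ℂ) (N : ℕ) : Prop :=
  ∑ t ∈ Finset.range (N + 1), cubicCoeff p k m q t (N - t) * cubicBasis p a m q t (N - t) =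
    (thetaFac p (q ^ 2) (q ^ 2) N)⁻¹ *
      (thetaFac p (a * k * q / m ^ 2) (q ^ 2) N * thetaFac p (k / a) (q ^ 2) N)

/-- The substitution a = xm/s with s² = q pairs each factor depending on a with its mirror image
under x ↦ 1/x, the shape needed for interpolation. -/
lemma cubicBasis_eq_prod (p : ℂ) {x m s : ℂ} (hx : x ≠ 0) (hm : m ≠ 0) (hs : s ≠ 0) (t d : ℕ) :
    cubicBasis p (x * m / s) m (s ^ 2) t d = ∏ l ∈ Finset.range (t + d),
      (modTheta ((if l < t then s ^ (2 * l + 1) else m * s ^ (4 * l + 3)) * x) p *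
        modTheta ((if l < t then s ^ (2 * l + 1) else m * s ^ (4 * l + 3)) / x) p) := by
  rw [Finset.prod_range_add, cubicBasis]
  simp only [thetaFac]
  rw [← Finset.prod_mul_distrib, ← Finset.prod_mul_distrib]
  congr 1
  · refine Finset.prod_congr rfl fun l hl => ?_
    rw [if_pos (Finset.mem_range.mp hl)]
    congr 2
    · field_simp; ring
    · field_simp; ring
  · refine Finset.prod_congr rfl fun l hl => ?_
    rw [if_neg (by omega), mul_comm]
    congr 2
    · field_simp
      ring
    · field_simp
      ring

lemma cubicRhs_eq_prod (p : ℂ) {x k m s : ℂ} (hx : x ≠ 0) (hm : m ≠ 0) (hs : s ≠ 0) (N : ℕ) :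
    thetaFac p (x * m / s * k * s ^ 2 / m ^ 2) ((s ^ 2) ^ 2) N *
      thetaFac p (k / (x * m / s)) ((s ^ 2) ^ 2) N = ∏ l ∈ Finset.range N,
      (modTheta (k * s ^ (4 * l + 1) / m * x) p * modTheta (k * s ^ (4 * l + 1) / m / x) p) := by
  simp only [thetaFac]
  rw [← Finset.prod_mul_distrib]
  refine Finset.prod_congr rfl fun l _ => ?_
  congr 2
  · field_simp
    ring
  · field_simp
    ring

/-- The factor (m/a; q)_t contains θ(1) for t > 0. The term t = 0 is matched by splitting the
q-factorials into q²-factorials. -/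
lemma cubicSum_of_eq {p k m q : ℂ} (hp : ‖p‖ < 1) (hm0 : m ≠ 0)
    (hm : ∀ j : ℕ, modTheta (m * q ^ j) p ≠ 0) (N : ℕ) : CubicSum p m k m q N := by
  rw [CubicSum, Finset.sum_eq_single 0]
  · have h1 : thetaFac p m q (2 * N + 1) ≠ 0 := thetaFac_ne_zero fun j _ => hm j
    have h2 : m ^ 2 * q / m = m * q := by field_simp
    have h3 : m * k * q / m ^ 2 = k / m * q := by field_simp
    rw [thetaFac_succ', thetaFac_two_mul] at h1
    simp only [cubicCoeff, cubicBasis, thetaFac_zero, Nat.choose_zero_succ, pow_zero, mul_one,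
      Nat.sub_zero, mul_zero, zero_add, pow_one, h2, h3, one_mul, thetaFac_succ',
      thetaFac_two_mul]
    rw [show m * q * q = m * q ^ 2 by ring] at h1 ⊢
    simp only [mul_ne_zero_iff] at h1
    obtain ⟨h5, h6, h7⟩ := h1
    -- If (q²; q²)_N = 0, both sides are 0 by the convention x / 0 = 0.
    by_cases h4 : thetaFac p (q ^ 2) (q ^ 2) N = 0
    · simp [h4]
    · field_simp
  · intro t _ ht
    rw [cubicBasis, thetaFac_eq_zero_of_one hp (Nat.pos_of_ne_zero ht) (x := m / m)
      (by rw [pow_zero, mul_one, div_self hm0])]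
    ring
  · simp

/-! ### Reduction of the cubic sum at a = m²q^{2J-1} -/

section Reduction

variable {p k m q : ℂ}

/-- The factor by which the cubic sum at `a = m² q^(2J-1)` differs from a shorter one. -/
noncomputable def cubicFactor (p k m q : ℂ) (J n : ℕ) : ℂ :=
  thetaFac p (m ^ 2 * q / k) (q ^ 2) J * thetaFac p (k * q ^ (2 * (J + n))) (q ^ 2) J *
    q ^ (J.choose 2) * (k / m) ^ J * thetaFac p (q / (m * q ^ (2 * J))) q J *
    thetaFac p (q ^ 2) (q ^ 2) n / (thetaFac p (q ^ 2) (q ^ 2) (J + n) * thetaFac p (m * q ^ J) q J)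

/-- Each factorial of length J + i splits into a part free of i and a part with shifted parameters.
At this a the factorials in `cubicBasis` become quotients of factorials of q² and of mq^J, which
cancel against denominators of `cubicCoeff`. -/
lemma cubicTerm_reduction (hk0 : k ≠ 0) (hm0 : m ≠ 0) (hq0 : q ≠ 0)
    (hq : ∀ j : ℕ, modTheta (q ^ (2 * (j + 1))) p ≠ 0)
    (hm : ∀ j : ℕ, modTheta (m * q ^ j) p ≠ 0) (J i d : ℕ) :
    cubicCoeff p k m q (J + i) d * cubicBasis p (m ^ 2 * q ^ (2 * J) / q) m q (J + i) d =
      cubicFactor p k m q J (i + d) *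
        (cubicCoeff p (k * q ^ (4 * J)) (m * q ^ (3 * J)) q i d *
          cubicBasis p (q ^ (2 * J)) (m * q ^ (3 * J)) q i d) := by
  have hQ (n : ℕ) : thetaFac p (q ^ 2) (q ^ 2) n ≠ 0 := thetaFac_ne_zero fun j _ => by
    have := hq j
    rwa [show q ^ 2 * (q ^ 2) ^ j = q ^ (2 * (j + 1)) by ring]
  have hM (l n : ℕ) : thetaFac p (m * q ^ l) q n ≠ 0 := thetaFac_ne_zero fun j _ => by
    have := hm (l + j)
    rwa [pow_add, ← mul_assoc] at this
  have f2 : thetaFac p (m ^ 2 * q / k) (q ^ 2) (J + i) = thetaFac p (m ^ 2 * q / k) (q ^ 2) J *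
      thetaFac p ((m * q ^ (3 * J)) ^ 2 * q / (k * q ^ (4 * J))) (q ^ 2) i := by
    rw [thetaFac_add]; congr 2; field_simp; ring
  have f3 : k * q ^ (4 * J) * q ^ i / (m * q ^ (3 * J)) = k * q ^ (J + i) / m := by
    field_simp; ring
  have f4 : thetaFac p (k * q ^ (2 * (J + i + d))) (q ^ 2) (J + i) =
      thetaFac p (k * q ^ (2 * (J + (i + d)))) (q ^ 2) J *
      thetaFac p (k * q ^ (4 * J) * q ^ (2 * (i + d))) (q ^ 2) i := by
    rw [thetaFac_add, add_assoc]; congr 2; ring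
  have f5 : k * q ^ (4 * J) / (m * q ^ (3 * J)) = k / m * q ^ J := by
    field_simp; ring
  have f6 : thetaFac p (m ^ 2 * q ^ (2 * (J + i) + 1) / (m ^ 2 * q ^ (2 * J) / q)) (q ^ 2) d =
      thetaFac p (q ^ 2) (q ^ 2) (i + d) / thetaFac p (q ^ 2) (q ^ 2) i := by
    rw [thetaFac_add, mul_div_cancel_left₀ _ (hQ i)]; congr 1; field_simp; ring
  have f7 : thetaFac p (q ^ (2 * J) * q ^ (2 * i + 2)) (q ^ 2) d =
      thetaFac p (q ^ 2) (q ^ 2) (J + (i + d)) / thetaFac p (q ^ 2) (q ^ 2) (J + i) := by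
    rw [← add_assoc, thetaFac_add, mul_div_cancel_left₀ _ (hQ _)]; congr 1; ring
  have f8 : m ^ 2 * q ^ (2 * J) / q * q ^ (2 * (J + i) + 2) =
      (m * q ^ (3 * J)) ^ 2 * q ^ (2 * i + 1) / q ^ (2 * J) := by
    field_simp; ring
  have f9 : thetaFac p (m ^ 2 * q ^ (2 * J) / q * q / m) q (J + i) =
      thetaFac p (m * q ^ J) q i * thetaFac p (m * q ^ (J + i)) q (2 * J) /
        thetaFac p (m * q ^ J) q J := by
    have h1 := thetaFac_add p (m * q ^ J) q J (J + i)
    have h2 := thetaFac_add p (m * q ^ J) q i (2 * J)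
    rw [show J + (J + i) = i + 2 * J by ring, h2, mul_assoc m, ← pow_add, mul_assoc m,
      ← pow_add, ← two_mul] at h1
    rw [h1, mul_div_cancel_left₀ _ (hM J J)]; congr 1; field_simp
  have f10 : thetaFac p (m * q ^ (J + i)) q (2 * (J + i + d) + 1) =
      thetaFac p (m * q ^ (J + i)) q (2 * J) *
        thetaFac p (m * q ^ (3 * J) * q ^ i) q (2 * (i + d) + 1) := by
    rw [show 2 * (J + i + d) + 1 = 2 * J + (2 * (i + d) + 1) by ring, thetaFac_add]
    congr 2; ring
  have f11 : thetaFac p (m / (m ^ 2 * q ^ (2 * J) / q)) q (J + i) =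
      thetaFac p (q / (m * q ^ (2 * J))) q J *
        thetaFac p (q ^ (2 * J) * q / (m * q ^ (3 * J))) q i := by
    rw [thetaFac_add]
    congr 2
    · field_simp
    · field_simp; ring
  have f12 : m * q ^ (3 * J) / q ^ (2 * J) = m * q ^ J := by
    field_simp; ring
  have f13 : m * q ^ (3 * J) * q ^ (3 * i) = m * q ^ (3 * (J + i)) := by ring
  have f14 : q ^ ((J + i).choose 2) * (k / m) ^ (J + i) = q ^ (J.choose 2) * (k / m) ^ J *
      (q ^ (i.choose 2) * (k / m * q ^ J) ^ i) := by
    rw [choose_two_add]; ring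
  have n4 := hQ (J + (i + d))
  have n6 := hM (J + i) (2 * J)
  simp only [cubicCoeff, cubicBasis, cubicFactor]
  rw [mul_assoc _ (q ^ ((J + i).choose 2)), f14, f2, f3, f4, f5, f6, f7, f8, f9, f10, f11, f12, f13]
  have aux : ∀ {A1 A2 A3 A4 A5 A6 A7 : ℂ} (A8 B1 B2 B3 B4 B5 B6 B7 B8 B9 B10 C1 C2 K1 K2 : ℂ),
      A4 ≠ 0 → A6 ≠ 0 →
      B1 * (B2 * B3) * B4 * (B5 * B6) * (C1 * K1 * (C2 * K2)) / (A2 * A3 * (A6 * A7)) *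
        (B10 * A6 / A5 * (B7 * B8) * (A8 / A1 * B9)) =
      B2 * B5 * C1 * K1 * B7 * A8 / (A4 * A5) *
        (B1 * B3 * B4 * B6 * C2 * K2 / (A2 * A1 * A7) * (B8 * B10 * (B9 * (A4 / A3)))) := by
    intro A1 A2 A3 A4 A5 A6 A7 A8 B1 B2 B3 B4 B5 B6 B7 B8 B9 B10 C1 C2 K1 K2 h4 h6
    trans B1 * B2 * B3 * B4 * B5 * B6 * B7 * B8 * B9 * B10 * C1 * C2 * K1 * K2 * A8 * A1⁻¹ * A2⁻¹ *
      A3⁻¹ * A5⁻¹ * A7⁻¹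
    · rw [← mul_one (_ * A7⁻¹), ← mul_inv_cancel₀ h6]
      ring
    · rw [← mul_one (_ * A7⁻¹), ← mul_inv_cancel₀ h4]
      ring
  exact aux _ _ _ _ _ _ _ _ _ _ _ _ _ _ _ n4 n6

lemma cubicRhs_reduction (hp : ‖p‖ < 1) (hk0 : k ≠ 0) (hm0 : m ≠ 0) (hq0 : q ≠ 0)
    (hq : ∀ j : ℕ, modTheta (q ^ (2 * (j + 1))) p ≠ 0)
    (hm : ∀ j : ℕ, modTheta (m * q ^ j) p ≠ 0) (J n : ℕ) :
    (thetaFac p (q ^ 2) (q ^ 2) (J + n))⁻¹ *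
      (thetaFac p (m ^ 2 * q ^ (2 * J) / q * k * q / m ^ 2) (q ^ 2) (J + n) *
        thetaFac p (k / (m ^ 2 * q ^ (2 * J) / q)) (q ^ 2) (J + n)) =
    cubicFactor p k m q J n * ((thetaFac p (q ^ 2) (q ^ 2) n)⁻¹ *
      (thetaFac p (q ^ (2 * J) * (k * q ^ (4 * J)) * q / (m * q ^ (3 * J)) ^ 2) (q ^ 2) n *
        thetaFac p (k * q ^ (4 * J) / q ^ (2 * J)) (q ^ 2) n)) := by
  have hQ (n : ℕ) : thetaFac p (q ^ 2) (q ^ 2) n ≠ 0 := thetaFac_ne_zero fun j _ => by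
    have := hq j
    rwa [show q ^ 2 * (q ^ 2) ^ j = q ^ (2 * (j + 1)) by ring]
  have hM : thetaFac p (m * q ^ J) q J ≠ 0 := thetaFac_ne_zero fun j _ => by
    have := hm (J + j)
    rwa [pow_add, ← mul_assoc] at this
  have g1 : thetaFac p (m ^ 2 * q ^ (2 * J) / q * k * q / m ^ 2) (q ^ 2) (J + n) =
      thetaFac p (k * q ^ (4 * J) / q ^ (2 * J)) (q ^ 2) n *
        thetaFac p (k * q ^ (2 * (J + n))) (q ^ 2) J := by
    rw [add_comm J n, thetaFac_add]
    congr 2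
    · field_simp; ring
    · field_simp; ring
  have g2 : thetaFac p (k / (m ^ 2 * q ^ (2 * J) / q)) (q ^ 2) (J + n) =
      thetaFac p (k / (m ^ 2 * q ^ (2 * J) / q)) (q ^ 2) J *
      thetaFac p (q ^ (2 * J) * (k * q ^ (4 * J)) * q / (m * q ^ (3 * J)) ^ 2) (q ^ 2) n := by
    rw [thetaFac_add]
    congr 2
    field_simp; ring
  have g3 := thetaFac_reverse hp (x := m * q ^ J) (y := q / (m * q ^ (2 * J))) (b := q) (n := J)
    (mul_ne_zero hm0 (pow_ne_zero _ hq0)) hq0 (by field_simp; ring)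
  have g4 := thetaFac_reverse hp (x := m ^ 2 * q / k) (y := k / (m ^ 2 * q ^ (2 * J) / q))
    (b := q ^ 2) (n := J) (by positivity) (pow_ne_zero _ hq0) (by field_simp; ring)
  have g5 : (-(m * q ^ J)) ^ J * q ^ J.choose 2 = (-(m ^ 2 * q / k)) ^ J *
      (q ^ 2) ^ J.choose 2 * q ^ J.choose 2 * (k / m) ^ J := by
    have h1 : q ^ (J * J) = q ^ J * (q ^ 2) ^ J.choose 2 := by
      rw [← add_two_mul_choose_two, pow_add, pow_mul]
    calc _ = (-m) ^ J * q ^ (J * J) * q ^ J.choose 2 := by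
          rw [neg_pow, mul_pow, neg_pow m, pow_mul]; ring
      _ = (-(m ^ 2 * q / k) * (k / m)) ^ J * (q ^ 2) ^ J.choose 2 * q ^ J.choose 2 := by
          rw [h1, show -(m ^ 2 * q / k) * (k / m) = -m * q by field_simp, mul_pow]; ring
      _ = _ := by rw [mul_pow]; ring
  -- Both J-fold factorials with inverted arguments are reversed; `g5` matches the resulting
  -- monomials.
  have key : thetaFac p (k / (m ^ 2 * q ^ (2 * J) / q)) (q ^ 2) J =
      thetaFac p (m ^ 2 * q / k) (q ^ 2) J * q ^ J.choose 2 * (k / m) ^ J *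
        thetaFac p (q / (m * q ^ (2 * J))) q J / thetaFac p (m * q ^ J) q J := by
    rw [eq_div_iff hM, ← g4, ← g3, g5]; ring
  have n1 := hQ n
  have n2 := hQ (J + n)
  rw [g1, g2, cubicFactor, key]
  generalize (k / m) ^ J = K
  generalize q ^ J.choose 2 = B0
  generalize thetaFac p (m * q ^ J) q J = B1 at *
  generalize thetaFac p (q ^ 2) (q ^ 2) n = B2 at *
  generalize thetaFac p (q ^ 2) (q ^ 2) (J + n) = B3 at *
  generalize thetaFac p (q / (m * q ^ (2 * J))) q J = B4
  field_simp

/-- For t < J the factorial (m²q^{2t+1}/a; q²)_{J+n-t} contains θ(1), at position J - 1 - t; the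
terms t = J + i form the shorter sum. -/
lemma cubicSum_reduction (hp : ‖p‖ < 1) (hk0 : k ≠ 0) (hm0 : m ≠ 0) (hq0 : q ≠ 0)
    (hq : ∀ j : ℕ, modTheta (q ^ (2 * (j + 1))) p ≠ 0)
    (hm : ∀ j : ℕ, modTheta (m * q ^ j) p ≠ 0) {J n : ℕ} (hJ : 0 < J)
    (h : CubicSum p (q ^ (2 * J)) (k * q ^ (4 * J)) (m * q ^ (3 * J)) q n) :
    CubicSum p (m ^ 2 * q ^ (2 * J) / q) k m q (J + n) := by
  rw [CubicSum, cubicRhs_reduction hp hk0 hm0 hq0 hq hm, ← h, add_assoc, Finset.sum_range_add,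
    Finset.sum_eq_zero, zero_add, Finset.mul_sum]
  · refine Finset.sum_congr rfl fun i hi => ?_
    obtain ⟨d, rfl⟩ := Nat.exists_eq_add_of_le (Nat.lt_succ_iff.mp (Finset.mem_range.mp hi))
    rw [show J + (i + d) - (J + i) = d by omega, show i + d - i = d by omega,
      cubicTerm_reduction hk0 hm0 hq0 hq hm]
  · intro t ht
    have ht := Finset.mem_range.mp ht
    rw [cubicBasis, thetaFac_eq_zero_of_one hp (j := J - 1 - t) (n := J + n - t) (by omega), zero_mul,
      mul_zero, mul_zero]
    obtain ⟨e, rfl⟩ : ∃ e, J = t + e + 1 := ⟨J - 1 - t, by omega⟩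
    rw [show t + e + 1 - 1 - t = e by omega]
    field_simp
    ring

end Reduction

/-! ### The cubic sum: interpolation for generic m, then continuity -/

lemma cubicSum_of_generic {p q : ℂ} (hp : ‖p‖ < 1) (hq0 : q ≠ 0)
    (hq : ∀ j : ℕ, modTheta (q ^ (2 * (j + 1))) p ≠ 0) (N : ℕ) :
    ∀ a k m : ℂ, a ≠ 0 → k ≠ 0 → m ≠ 0 → (∀ j : ℕ, modTheta (m * q ^ j) p ≠ 0) →
      (∀ j : ℕ, modTheta (m ^ 2 * q ^ (2 * j + 1)) p ≠ 0) → CubicSum p a k m q N := by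
  induction N using Nat.strong_induction_on with
  | _ N ih =>
  intro a k m ha0 hk0 hm0 hm hm2
  obtain ⟨s, rfl⟩ : ∃ s : ℂ, q = s ^ 2 := by
    obtain ⟨s, hs⟩ := IsAlgClosed.exists_pow_nat_eq q two_pos
    exact ⟨s, hs.symm⟩
  have hs0 : s ≠ 0 := by rintro rfl; simp at hq0
  -- In the variable x = as/m these are the nodes a = m (j = 0) and a = m²q^{2j-1} (j ≥ 1).
  set X : ℕ → ℂ := fun j => if j = 0 then s else m * s ^ (4 * j) / s with hX
  have hX0 (j : ℕ) : X j ≠ 0 := by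
    simp only [hX]; split_ifs <;> positivity
  have hpts : ∀ j ≤ N, CubicSum p (X j * m / s) k m (s ^ 2) N := by
    intro j hj
    rcases Nat.eq_zero_or_pos j with rfl | hj0
    · rw [show X 0 * m / s = m by simp only [hX, if_true]; field_simp]
      exact cubicSum_of_eq hp hm0 hm N
    · obtain ⟨n, rfl⟩ := Nat.exists_eq_add_of_le hj
      rw [show X j * m / s = m ^ 2 * (s ^ 2) ^ (2 * j) / s ^ 2 by
        simp only [hX, if_neg hj0.ne']; field_simp; ring]
      refine cubicSum_reduction hp hk0 hm0 hq0 hq hm hj0 (ih n (by omega) _ _ _ (by positivity)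
        (by positivity) (by positivity) (fun i => ?_) (fun i => ?_))
      · have := hm (3 * j + i)
        rwa [pow_add, ← mul_assoc] at this
      · have := hm2 (3 * j + i)
        rwa [show (m * (s ^ 2) ^ (3 * j)) ^ 2 * (s ^ 2) ^ (2 * i + 1) =
          m ^ 2 * (s ^ 2) ^ (2 * (3 * j + i) + 1) by ring]
  -- The extra index N + 1 carries the right-hand side with a minus sign, so the identity becomes
  -- the vanishing of a single combination.
  set c : ℕ → ℂ := fun t => if t = N + 1 then -(thetaFac p ((s ^ 2) ^ 2) ((s ^ 2) ^ 2) N)⁻¹ else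
    cubicCoeff p k m (s ^ 2) t (N - t) with hc
  set Y : ℕ → ℕ → ℂ := fun t l => if t = N + 1 then k * s ^ (4 * l + 1) / m else
    if l < t then s ^ (2 * l + 1) else m * s ^ (4 * l + 3) with hY
  have hform (x : ℂ) (hx : x ≠ 0) : CubicSum p (x * m / s) k m (s ^ 2) N ↔
      ∑ t ∈ Finset.range (N + 1 + 1), c t * ∏ l ∈ Finset.range N,
        (modTheta (Y t l * x) p * modTheta (Y t l / x) p) = 0 := by
    rw [Finset.sum_range_succ, CubicSum, cubicRhs_eq_prod p hx hm0 hs0, ← sub_eq_zero]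
    simp only [hc, hY, if_true, neg_mul, ← sub_eq_add_neg]
    have : ∀ u v w : ℂ, u = v → (u - w = 0 ↔ v - w = 0) := by rintro u v w rfl; rfl
    refine this _ _ _ (Finset.sum_congr rfl fun t ht => ?_)
    have ht := Finset.mem_range.mp ht
    obtain ⟨d, rfl⟩ := Nat.exists_eq_add_of_le (Nat.lt_succ_iff.mp ht)
    simp only [if_neg ht.ne]
    rw [show t + d - t = d by omega, cubicBasis_eq_prod p hx hm0 hs0]
  have hax : a = a * s / m * m / s := by field_simp
  rw [hax, hform _ (by positivity)]
  refine sum_prod_modTheta_eq_zero hp _ N c Y (fun t l => ?_) X hX0 (fun i j hij hj => ?_)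
    (fun j hj => (hform _ (hX0 j)).mp (hpts j hj)) (by positivity)
  · simp only [hY]; split_ifs <;> positivity
  -- Independence of nodes: a pair with i = 0 gives θ(mq^{2j}) and θ(mq^{2j-1}); a pair with i > 0
  -- gives θ at m² times an odd power of q, the only use of genericity here, and at q^{2(j-i)}.
  · have hj0 : j ≠ 0 := by omega
    rcases Nat.eq_zero_or_pos i with rfl | hi0
    · simp only [hX, if_true, if_neg hj0]
      obtain ⟨e, rfl⟩ : ∃ e, j = e + 1 := ⟨j - 1, by omega⟩
      refine mul_ne_zero ?_ ?_
      · rw [show m * s ^ (4 * (e + 1)) / s * s = m * (s ^ 2) ^ (2 * e + 2) by field_simp; ring]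
        exact hm _
      · rw [show m * s ^ (4 * (e + 1)) / s / s = m * (s ^ 2) ^ (2 * e + 1) by field_simp; ring]
        exact hm _
    · simp only [hX, if_neg hi0.ne', if_neg hj0]
      obtain ⟨e, rfl⟩ : ∃ e, i = e + 1 := ⟨i - 1, by omega⟩
      obtain ⟨f, rfl⟩ : ∃ f, j = e + 1 + (f + 1) := ⟨j - (e + 1) - 1, by omega⟩
      refine mul_ne_zero ?_ ?_
      · rw [show m * s ^ (4 * (e + 1 + (f + 1))) / s * (m * s ^ (4 * (e + 1)) / s) =
          m ^ 2 * (s ^ 2) ^ (2 * (2 * e + f + 2) + 1) by field_simp; ring]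
        exact hm2 _
      · rw [show m * s ^ (4 * (e + 1 + (f + 1))) / s / (m * s ^ (4 * (e + 1)) / s) =
          (s ^ 2) ^ (2 * (f + 1)) by field_simp; ring]
        exact hq f

lemma ContinuousAt.thetaFac {p b z : ℂ} (hp : ‖p‖ < 1) (hb : b ≠ 0) {f : ℂ → ℂ}
    (hf : ContinuousAt f z) (hz : f z ≠ 0) (n : ℕ) :
    ContinuousAt (fun w => thetaFac p (f w) b n) z := by
  induction n with
  | zero => simpa using continuousAt_const
  | succ n ih =>
    simp only [thetaFac_succ]
    exact ih.mul (ContinuousAt.comp (f := fun w => f w * b ^ n)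
      (continuousAt_modTheta hp (mul_ne_zero hz (pow_ne_zero n hb))) (hf.mul continuousAt_const))

lemma countable_sq_mul_mem {S : Set ℂ} (hS : S.Countable) {c : ℂ} (hc : c ≠ 0) :
    {z : ℂ | z ^ 2 * c ∈ S}.Countable := by
  have h : {z : ℂ | z ^ 2 * c ∈ S} = ⋃ w ∈ S, {z : ℂ | z ^ 2 = w / c} := by
    ext z
    simp [eq_div_iff hc]
  rw [h]
  refine hS.biUnion fun w _ => Set.Finite.countable ?_
  obtain ⟨r, hr⟩ := IsAlgClosed.exists_pow_nat_eq (w / c) two_pos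
  refine (Set.toFinite {r, -r}).subset fun z hz => ?_
  rw [Set.mem_ofPred_eq, ← hr] at hz
  exact sq_eq_sq_iff_eq_or_eq_neg.mp hz

/-- Each condition excludes countably many m, and the complement of a countable set in ℂ is dense.
-/
lemma dense_generic {p q : ℂ} (hp : ‖p‖ < 1) (hq0 : q ≠ 0) :
    Dense {m : ℂ | m ≠ 0 ∧ (∀ j : ℕ, modTheta (m * q ^ j) p ≠ 0) ∧
      ∀ j : ℕ, modTheta (m ^ 2 * q ^ (2 * j + 1)) p ≠ 0} := by
  have hZ := countable_modTheta_eq_zero hp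
  have hB : ({0} ∪ ((⋃ j : ℕ, {m : ℂ | m * q ^ j ∈ {z : ℂ | z ≠ 0 ∧ modTheta z p = 0}}) ∪
      ⋃ j : ℕ, {m : ℂ | m ^ 2 * q ^ (2 * j + 1) ∈ {z : ℂ | z ≠ 0 ∧ modTheta z p = 0}})).Countable := by
    refine (Set.countable_singleton 0).union ((Set.countable_iUnion fun j => ?_).union
      (Set.countable_iUnion fun j => countable_sq_mul_mem hZ (pow_ne_zero _ hq0)))
    exact hZ.preimage_of_injOn (f := fun m => m * q ^ j)
      (mul_left_injective₀ (pow_ne_zero _ hq0)).injOn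
  refine (hB.dense_compl ℂ).mono fun m hm => ?_
  simp only [Set.mem_compl_iff, Set.mem_union, Set.mem_singleton_iff, Set.mem_iUnion,
    Set.mem_ofPred_eq, not_or, not_exists, not_and] at hm
  obtain ⟨h0, h1, h2⟩ := hm
  exact ⟨h0, fun j => h1 j (mul_ne_zero h0 (pow_ne_zero _ hq0)),
    fun j => h2 j (mul_ne_zero (pow_ne_zero _ h0) (pow_ne_zero _ hq0))⟩

/-- The cubic theta hypergeometric summation formula. -/
theorem cubicSum {p a k m q : ℂ} (hp : ‖p‖ < 1) (ha0 : a ≠ 0) (hk0 : k ≠ 0) (hm0 : m ≠ 0)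
    (hq0 : q ≠ 0) (hq : ∀ j : ℕ, modTheta (q ^ (2 * (j + 1))) p ≠ 0)
    (hm : ∀ j : ℕ, modTheta (m * q ^ j) p ≠ 0) (N : ℕ) : CubicSum p a k m q N := by
  have hq20 : q ^ 2 ≠ 0 := pow_ne_zero _ hq0
  have hQ (n : ℕ) : thetaFac p (q ^ 2) (q ^ 2) n ≠ 0 := thetaFac_ne_zero fun j _ => by
    have := hq j
    rwa [show q ^ 2 * (q ^ 2) ^ j = q ^ (2 * (j + 1)) by ring]
  have hM (l n : ℕ) : thetaFac p (m * q ^ l) q n ≠ 0 := thetaFac_ne_zero fun j _ => by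
    have := hm (l + j)
    rwa [pow_add, ← mul_assoc] at this
  have h1 : ContinuousAt (fun m' => ∑ t ∈ Finset.range (N + 1),
      cubicCoeff p k m' q t (N - t) * cubicBasis p a m' q t (N - t)) m := by
    refine tendsto_finsetSum _ fun t _ => ?_
    change ContinuousAt (fun m' => cubicCoeff p k m' q t (N - t) * cubicBasis p a m' q t (N - t)) m
    simp only [cubicCoeff, cubicBasis]
    refine ContinuousAt.mul (ContinuousAt.div (ContinuousAt.mul (ContinuousAt.mul (ContinuousAt.mul
      (ContinuousAt.mul (ContinuousAt.mul ?_ ?_) ?_) ?_) ?_) ?_) (ContinuousAt.mul ?_ ?_) ?_)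
      (ContinuousAt.mul (ContinuousAt.mul ?_ ?_) (ContinuousAt.mul ?_ ?_))
    · exact ContinuousAt.comp (f := fun w => w * q ^ (3 * t))
        (continuousAt_modTheta hp (by positivity)) (by fun_prop)
    · exact ContinuousAt.thetaFac hp hq20 (by fun_prop) (by positivity) _
    · exact ContinuousAt.thetaFac hp hq0 (by fun_prop (disch := assumption)) (by positivity) _
    · exact continuousAt_const
    · exact continuousAt_const
    · fun_prop (disch := assumption)
    · exact continuousAt_const
    · exact ContinuousAt.thetaFac hp hq0 (by fun_prop) (by positivity) _
    · exact mul_ne_zero (mul_ne_zero (hQ _) (hQ _)) (hM _ _)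
    · exact ContinuousAt.thetaFac hp hq0 (by fun_prop (disch := assumption)) (by positivity) _
    · exact ContinuousAt.thetaFac hp hq0 (by fun_prop) (by positivity) _
    · exact ContinuousAt.thetaFac hp hq20 (by fun_prop) (by positivity) _
    · exact continuousAt_const
  have h2 : ContinuousAt (fun m' => (thetaFac p (q ^ 2) (q ^ 2) N)⁻¹ *
      (thetaFac p (a * k * q / m' ^ 2) (q ^ 2) N * thetaFac p (k / a) (q ^ 2) N)) m := by
    refine continuousAt_const.mul (ContinuousAt.mul ?_ continuousAt_const)
    exact ContinuousAt.thetaFac hp hq20 (f := fun w => a * k * q / w ^ 2)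
      (by fun_prop (disch := positivity)) (by positivity) _
  -- If the two sides differed at m, they would differ on a neighbourhood, which contains a generic
  -- m'.
  by_contra hne
  have h3 := (h1.sub h2).eventually_ne (sub_ne_zero.mpr hne)
  obtain ⟨m', hm', hne'⟩ := (dense_generic hp hq0).inter_nhds_nonempty h3
  exact hne' (sub_eq_zero.mpr (cubicSum_of_generic hp hq0 hq N a k m' ha0 hk0 hm'.1 hm'.2.1 hm'.2.2))

/-! ### Three-term relation and telescoping inversion sum -/

/-- The three-term relation of Weierstrass. -/
lemma modTheta_three_term {p : ℂ} (hp : ‖p‖ < 1) {u v w z : ℂ} (hu : u ≠ 0) (hv : v ≠ 0)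
    (hw : w ≠ 0) (hz : z ≠ 0) :
    modTheta (u * v) p * modTheta (u / v) p * (modTheta (w * z) p * modTheta (w / z) p) -
      w / v * (modTheta (u * w) p * modTheta (u / w) p *
        (modTheta (v * z) p * modTheta (v / z) p)) =
    modTheta (w * v) p * modTheta (w / v) p * (modTheta (u * z) p * modTheta (u / z) p) := by
  obtain ⟨o, e, h⟩ := exists_modTheta_bracket hp
  rw [h u v hu hv, h w z hw hz, h u w hu hw, h v z hv hz, h w v hw hv, h u z hu hz]
  field_simp
  ring

/-- The Weierstrass relation at u = cb^{n+d}, v = cb^n, w = Kb^n/c, z = c with c² = A; it is the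
telescoping step below. -/
lemma modTheta_three_term_base {p A K b : ℂ} (hp : ‖p‖ < 1) (hA : A ≠ 0) (hK : K ≠ 0)
    (hb : b ≠ 0) (n d : ℕ) :
    modTheta (b ^ d) p * modTheta (A * b ^ (n + d + n)) p * modTheta (K * b ^ n) p *
        modTheta (K / A * b ^ n) p -
      K / A * (modTheta (A / K * b ^ d) p * modTheta (K * b ^ (n + d + n)) p *
        modTheta (b ^ n) p * modTheta (A * b ^ n) p) =
    modTheta (K * b ^ (2 * n)) p * modTheta (K / A) p * modTheta (b ^ (n + d)) p *
      modTheta (A * b ^ (n + d)) p := by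
  obtain ⟨c, rfl⟩ : ∃ c : ℂ, A = c ^ 2 := by
    obtain ⟨c, hc⟩ := IsAlgClosed.exists_pow_nat_eq A two_pos
    exact ⟨c, hc.symm⟩
  have hc : c ≠ 0 := by rintro rfl; simp at hA
  have h := modTheta_three_term hp (u := c * b ^ (n + d)) (v := c * b ^ n) (w := K * b ^ n / c)
    (z := c) (by positivity) (by positivity) (by positivity) hc
  rw [show c * b ^ (n + d) * (c * b ^ n) = c ^ 2 * b ^ (n + d + n) by ring,
    show c * b ^ (n + d) / (c * b ^ n) = b ^ d by field_simp; ring,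
    show K * b ^ n / c * c = K * b ^ n by field_simp,
    show K * b ^ n / c / c = K / c ^ 2 * b ^ n by field_simp,
    show K * b ^ n / c / (c * b ^ n) = K / c ^ 2 by field_simp,
    show c * b ^ (n + d) * (K * b ^ n / c) = K * b ^ (n + d + n) by field_simp; ring,
    show c * b ^ (n + d) / (K * b ^ n / c) = c ^ 2 / K * b ^ d by field_simp; ring,
    show c * b ^ n * c = c ^ 2 * b ^ n by ring,
    show c * b ^ n / c = b ^ n by field_simp,
    show K * b ^ n / c * (c * b ^ n) = K * b ^ (2 * n) by field_simp; ring,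
    show c * b ^ (n + d) * c = c ^ 2 * b ^ (n + d) by ring,
    show c * b ^ (n + d) / c = b ^ (n + d) by field_simp] at h
  linear_combination h

/-- The terms of the very-well-poised sum expressing that two triangular matrices are inverse to
each other. -/
noncomputable def inversionTerm (p A K b : ℂ) (N t : ℕ) : ℂ :=
  modTheta (K * b ^ (2 * t)) p * (thetaFac p (A / K) b (N - t) / thetaFac p b b (N - t)) *
    (thetaFac p A b (N + t) / thetaFac p (K * b) b (N + t)) * (K / A) ^ (N - t) *
    (thetaFac p (K / A) b t / thetaFac p b b t * (thetaFac p K b t / thetaFac p (A * b) b t))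

/-- The partial sums of `inversionTerm`. -/
noncomputable def inversionPartialSum (p A K b : ℂ) (N n : ℕ) : ℂ :=
  modTheta K p / (modTheta (b ^ N) p * modTheta (A * b ^ N) p) *
    (thetaFac p (A / K) b (N - n) * modTheta (b ^ (N - n)) p / thetaFac p b b (N - n)) *
    (thetaFac p A b (N + n + 1) / thetaFac p (K * b) b (N + n)) * (K / A) ^ (N - n) *
    (thetaFac p (K * b) b n * thetaFac p (K / A * b) b n /
      (thetaFac p b b n * thetaFac p (A * b) b n))

lemma sum_inversionTerm {p A K b : ℂ} (hp : ‖p‖ < 1) (hA0 : A ≠ 0) (hK0 : K ≠ 0) (hb0 : b ≠ 0)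
    (hb : ∀ j : ℕ, modTheta (b ^ (j + 1)) p ≠ 0) (hA : ∀ j : ℕ, modTheta (A * b ^ j) p ≠ 0)
    (hK : ∀ j : ℕ, modTheta (K * b ^ j) p ≠ 0) {N : ℕ} (hN : 0 < N) (n : ℕ) (hn : n ≤ N) :
    ∑ t ∈ Finset.range (n + 1), inversionTerm p A K b N t = inversionPartialSum p A K b N n := by
  have hbN : modTheta (b ^ N) p ≠ 0 := by
    obtain ⟨j, rfl⟩ : ∃ j, N = j + 1 := ⟨N - 1, by omega⟩
    exact hb j
  have hAN := hA N
  have hB (n : ℕ) : thetaFac p b b n ≠ 0 := thetaFac_ne_zero fun j _ => by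
    rw [← pow_succ']; exact hb j
  have hAb (n : ℕ) : thetaFac p (A * b) b n ≠ 0 := thetaFac_ne_zero fun j _ => by
    rw [mul_assoc, ← pow_succ']; exact hA _
  have hKb (n : ℕ) : thetaFac p (K * b) b n ≠ 0 := thetaFac_ne_zero fun j _ => by
    rw [mul_assoc, ← pow_succ']; exact hK _
  induction n with
  | zero =>
    have n1 := hB N
    have n2 := hKb N
    simp only [zero_add, Finset.sum_range_one, inversionTerm, inversionPartialSum, mul_zero,
      pow_zero, mul_one, Nat.sub_zero, add_zero, thetaFac_zero, div_one, thetaFac_succ]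
    generalize thetaFac p b b N = X1 at *
    generalize thetaFac p (K * b) b N = X2 at *
    generalize modTheta (b ^ N) p = X3 at *
    generalize modTheta (A * b ^ N) p = X4 at *
    field_simp
  | succ n ih =>
    obtain ⟨d, rfl⟩ := Nat.exists_eq_add_of_le hn
    rw [Finset.sum_range_succ, ih (by omega)]
    have h3 := modTheta_three_term_base hp hA0 hK0 hb0 (n + 1) d
    have e1 : b * b ^ n = b ^ (n + 1) := (pow_succ' b n).symm
    have e2 : b * b ^ d = b ^ (d + 1) := (pow_succ' b d).symm
    have e3 (x : ℂ) (j : ℕ) : x * b * b ^ j = x * b ^ (j + 1) := by ring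
    simp only [inversionTerm, inversionPartialSum]
    rw [show n + 1 + d - n = d + 1 by omega, show n + 1 + d - (n + 1) = d by omega,
      show n + 1 + d + (n + 1) = n + 1 + d + n + 1 by ring] at *
    simp only [thetaFac_succ p (A / K) b d, thetaFac_succ p b b d,
      thetaFac_succ p A b (n + 1 + d + n + 1), thetaFac_succ p (K * b) b (n + 1 + d + n),
      thetaFac_succ p (K * b) b n, thetaFac_succ p (K / A * b) b n, thetaFac_succ p b b n,
      thetaFac_succ p (A * b) b n, thetaFac_succ' p (K / A) b n, thetaFac_succ' p K b n,
      e1, e2, e3, pow_succ (K / A) d]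
    -- After removal of common factors, adding the next term to the partial sum is exactly `h3`.
    have aux : ∀ {θK g h Y y1 Z z1 B b1 D d1 : ℂ} (X x1 V L κ P R e θKA yd v1 p1 r1 : ℂ),
        g ≠ 0 → h ≠ 0 → y1 ≠ 0 → z1 ≠ 0 → b1 ≠ 0 → d1 ≠ 0 →
        yd * v1 * p1 * r1 - κ * (x1 * z1 * b1 * d1) = e * θKA * g * h →
        θK / (g * h) * (X * x1 * y1 / (Y * y1)) * (V / Z) * (L * κ) * (P * R / (B * D)) +
          e * (X / Y) * (V / (Z * z1)) * L * (θKA * R / (B * b1) * (θK * P / (D * d1))) =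
        θK / (g * h) * (X * yd / Y) * (V * v1 / (Z * z1)) * L *
          (P * p1 * (R * r1) / (B * b1 * (D * d1))) := by
      intro θK g h Y y1 Z z1 B b1 D d1 X x1 V L κ P R e θKA yd v1 p1 r1 hg hh hy hz hb hd h3
      trans θK * X * V * L * P * R * Y⁻¹ * Z⁻¹ * B⁻¹ * D⁻¹ *
        ((κ * (x1 * z1 * b1 * d1) + e * θKA * g * h) / (g * h * z1 * b1 * d1))
      · have : (κ * (x1 * z1 * b1 * d1) + e * θKA * g * h) / (g * h * z1 * b1 * d1) =
          κ * x1 / (g * h) + e * θKA / (z1 * b1 * d1) := by field_simp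
        rw [this, mul_div_mul_right _ _ hy]
        ring
      · rw [← h3]
        ring
    exact aux _ _ _ _ _ _ _ _ _ _ _ _ _ hbN hAN (hb d) (hK _) (hb n) (hA _) h3

/-- The complete sum contains the factor θ(b^{N-N}) = θ(1) = 0. -/
lemma sum_inversionTerm_eq_zero {p A K b : ℂ} (hp : ‖p‖ < 1) (hA0 : A ≠ 0) (hK0 : K ≠ 0)
    (hb0 : b ≠ 0) (hb : ∀ j : ℕ, modTheta (b ^ (j + 1)) p ≠ 0)
    (hA : ∀ j : ℕ, modTheta (A * b ^ j) p ≠ 0) (hK : ∀ j : ℕ, modTheta (K * b ^ j) p ≠ 0) {N : ℕ}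
    (hN : 0 < N) : ∑ t ∈ Finset.range (N + 1), inversionTerm p A K b N t = 0 := by
  rw [sum_inversionTerm hp hA0 hK0 hb0 hb hA hK hN N le_rfl, inversionPartialSum, Nat.sub_self,
    pow_zero, modTheta_one hp]
  ring

/-! ### Inversion of WP Bailey pairs -/

lemma sum_range_triangle (f : ℕ → ℕ → ℂ) (n : ℕ) :
    ∑ r ∈ Finset.range (n + 1), ∑ s ∈ Finset.range (r + 1), f r s =
      ∑ s ∈ Finset.range (n + 1), ∑ t ∈ Finset.range (n - s + 1), f (s + t) s := by
  rw [Finset.sum_comm' (t' := Finset.range (n + 1)) (s' := fun s => Finset.Ico s (n + 1))]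
  · refine Finset.sum_congr rfl fun s hs => ?_
    rw [Finset.sum_Ico_eq_sum_range, Nat.sub_add_comm (Nat.lt_succ_iff.mp (Finset.mem_range.mp hs))]
  · intro r s
    simp only [Finset.mem_range, Finset.mem_Ico]
    omega

/-- The inversion of the relation expressing `β` through `α` in a well-poised Bailey pair. -/
lemma bailey_inversion {p a k b : ℂ} (hp : ‖p‖ < 1) (ha0 : a ≠ 0) (hk0 : k ≠ 0) (hb0 : b ≠ 0)
    (hb : ∀ j : ℕ, modTheta (b ^ (j + 1)) p ≠ 0) (ha : ∀ j : ℕ, modTheta (a * b ^ j) p ≠ 0)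
    (hk : ∀ j : ℕ, modTheta (k * b ^ j) p ≠ 0) (α β : ℕ → ℂ)
    (hβ : ∀ n, β n = ∑ r ∈ Finset.range (n + 1),
      thetaFac p (k / a) b (n - r) / thetaFac p b b (n - r) *
        (thetaFac p k b (n + r) / thetaFac p (a * b) b (n + r)) * α r) (n : ℕ) :
    α n = modTheta (a * b ^ (2 * n)) p / modTheta a p * ∑ r ∈ Finset.range (n + 1),
      modTheta (k * b ^ (2 * r)) p / modTheta k p *
        (thetaFac p (a / k) b (n - r) / thetaFac p b b (n - r)) *
        (thetaFac p a b (n + r) / thetaFac p (k * b) b (n + r)) * (k / a) ^ (n - r) * β r := by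
  have ha' : modTheta a p ≠ 0 := by simpa using ha 0
  have hk' : modTheta k p ≠ 0 := by simpa using hk 0
  -- The coefficient of α_s is an inversion sum of length N = n - s with both parameters multiplied
  -- by b^{2s}; it vanishes unless s = n.
  have hinner : ∀ s t N : ℕ, t ≤ N → n = s + N →
      modTheta (k * b ^ (2 * (s + t))) p / modTheta k p *
        (thetaFac p (a / k) b (n - (s + t)) / thetaFac p b b (n - (s + t))) *
        (thetaFac p a b (n + (s + t)) / thetaFac p (k * b) b (n + (s + t))) *
        (k / a) ^ (n - (s + t)) *
        (thetaFac p (k / a) b (s + t - s) / thetaFac p b b (s + t - s) *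
        (thetaFac p k b (s + t + s) / thetaFac p (a * b) b (s + t + s)) * α s) =
      thetaFac p a b (2 * s) * thetaFac p k b (2 * s) /
        (modTheta k p * thetaFac p (k * b) b (2 * s) * thetaFac p (a * b) b (2 * s)) * α s *
        inversionTerm p (a * b ^ (2 * s)) (k * b ^ (2 * s)) b N t := by
    rintro s t N ht rfl
    rw [inversionTerm, show s + N - (s + t) = N - t by omega, show s + t - s = t by omega,
      show s + N + (s + t) = 2 * s + (N + t) by ring, show s + t + s = 2 * s + t by ring,
      thetaFac_add p a, thetaFac_add p (k * b), thetaFac_add p k, thetaFac_add p (a * b),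
      mul_div_mul_right a k (pow_ne_zero _ hb0), mul_div_mul_right k a (pow_ne_zero _ hb0),
      mul_right_comm k b, mul_right_comm a b, mul_add, pow_add, ← mul_assoc k]
    simp only [div_eq_mul_inv, mul_inv]
    ring
  simp only [hβ, Finset.mul_sum]
  rw [sum_range_triangle (fun r s => modTheta (a * b ^ (2 * n)) p / modTheta a p *
      (modTheta (k * b ^ (2 * r)) p / modTheta k p *
        (thetaFac p (a / k) b (n - r) / thetaFac p b b (n - r)) *
        (thetaFac p a b (n + r) / thetaFac p (k * b) b (n + r)) * (k / a) ^ (n - r) *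
        (thetaFac p (k / a) b (r - s) / thetaFac p b b (r - s) *
        (thetaFac p k b (r + s) / thetaFac p (a * b) b (r + s)) * α s)))]
  have hsum (s : ℕ) (hs : s ≤ n) : ∑ t ∈ Finset.range (n - s + 1),
      modTheta (a * b ^ (2 * n)) p / modTheta a p *
      (modTheta (k * b ^ (2 * (s + t))) p / modTheta k p *
        (thetaFac p (a / k) b (n - (s + t)) / thetaFac p b b (n - (s + t))) *
        (thetaFac p a b (n + (s + t)) / thetaFac p (k * b) b (n + (s + t))) *
        (k / a) ^ (n - (s + t)) *
        (thetaFac p (k / a) b (s + t - s) / thetaFac p b b (s + t - s) *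
        (thetaFac p k b (s + t + s) / thetaFac p (a * b) b (s + t + s)) * α s)) =
      modTheta (a * b ^ (2 * n)) p / modTheta a p *
        (thetaFac p a b (2 * s) * thetaFac p k b (2 * s) /
        (modTheta k p * thetaFac p (k * b) b (2 * s) * thetaFac p (a * b) b (2 * s)) * α s *
        ∑ t ∈ Finset.range (n - s + 1),
          inversionTerm p (a * b ^ (2 * s)) (k * b ^ (2 * s)) b (n - s) t) := by
    rw [Finset.mul_sum, Finset.mul_sum]
    refine Finset.sum_congr rfl fun t ht => ?_
    rw [hinner s t (n - s) (Nat.lt_succ_iff.mp (Finset.mem_range.mp ht)) (by omega)]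
  rw [Finset.sum_eq_single n]
  · rw [hsum n le_rfl, Nat.sub_self, zero_add, Finset.sum_range_one, inversionTerm]
    simp only [mul_zero, pow_zero, mul_one, Nat.sub_zero, add_zero, thetaFac_zero, div_one]
    have h1 := thetaFac_succ p a b (2 * n)
    rw [thetaFac_succ'] at h1
    have h2 := thetaFac_succ p k b (2 * n)
    rw [thetaFac_succ'] at h2
    have n1 : thetaFac p (a * b) b (2 * n) ≠ 0 := thetaFac_ne_zero fun j _ => by
      rw [mul_assoc, ← pow_succ']; exact ha _
    have n2 : thetaFac p (k * b) b (2 * n) ≠ 0 := thetaFac_ne_zero fun j _ => by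
      rw [mul_assoc, ← pow_succ']; exact hk _
    symm
    calc _ = (thetaFac p a b (2 * n) * modTheta (a * b ^ (2 * n)) p) *
          (thetaFac p k b (2 * n) * modTheta (k * b ^ (2 * n)) p) /
          (modTheta a p * thetaFac p (a * b) b (2 * n) *
          (modTheta k p * thetaFac p (k * b) b (2 * n))) * α n := by
          simp only [div_eq_mul_inv, mul_inv]; ring
      _ = α n := by
          rw [← h1, ← h2, div_self (mul_ne_zero (mul_ne_zero ha' n1) (mul_ne_zero hk' n2)), one_mul]
  · intro s hs hsn
    have hs := Finset.mem_range.mp hs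
    rw [hsum s (by omega), sum_inversionTerm_eq_zero hp (by positivity) (by positivity) hb0 hb
      (fun j => ?_) (fun j => ?_) (by omega), mul_zero, mul_zero]
    · rw [mul_assoc, ← pow_add]; exact ha _
    · rw [mul_assoc, ← pow_add]; exact hk _
  · simp

/-! ### Shifted factorials of negative index -/

lemma ellFac_neg (x b p : ℂ) (n : ℕ) :
    ellFac x b p (-(n : ℤ)) = (∏ j ∈ Finset.range n, modTheta (x / b ^ (j + 1)) p)⁻¹ := by
  cases n with
  | zero => simp [ellFac]
  | succ n => rfl

/-- Nonvanishing at the negative shifts is what allows a factor to be cancelled when z < 0. -/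
lemma ellFac_add_one {x b p : ℂ} (hx : ∀ j : ℕ, modTheta (x / b ^ (j + 1)) p ≠ 0) (z : ℤ) :
    ellFac x b p (z + 1) = ellFac x b p z * modTheta (x * b ^ z) p := by
  rcases le_or_gt 0 z with h | h
  · obtain ⟨n, rfl⟩ := Int.eq_ofNat_of_zero_le h
    rw [← Nat.cast_succ, ellFac_natCast, ellFac_natCast, thetaFac_succ, zpow_natCast]
  · obtain ⟨n, rfl⟩ : ∃ n : ℕ, z = -((n + 1 : ℕ) : ℤ) := ⟨(-z - 1).toNat, by omega⟩
    rw [show -((n + 1 : ℕ) : ℤ) + 1 = -(n : ℤ) by push_cast; ring, ellFac_neg, ellFac_neg,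
      Finset.prod_range_succ, zpow_neg, zpow_natCast, ← div_eq_mul_inv, mul_inv, mul_assoc,
      inv_mul_cancel₀ (hx n), mul_one]

lemma ellFac_sub {x b p : ℂ} (hb : b ≠ 0) (hx : ∀ j : ℕ, modTheta (x / b ^ (j + 1)) p ≠ 0)
    (t s : ℕ) :
    ellFac x b p ((t : ℤ) - s) = ellFac x b p (-(s : ℤ)) * thetaFac p (x / b ^ s) b t := by
  induction t with
  | zero => simp
  | succ t ih =>
    rw [show ((t + 1 : ℕ) : ℤ) - s = (t : ℤ) - s + 1 by push_cast; ring, ellFac_add_one hx, ih,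
      thetaFac_succ, mul_assoc, zpow_sub₀ hb, zpow_natCast, zpow_natCast, div_mul_eq_mul_div,
      mul_div_assoc]

/-- The arguments of the two factorials are mutually inverse, z and 1/z, and each quotient
θ(z)/θ(1/z) equals -z. This produces the sign and part of the power of q in α. -/
lemma thetaFac_mul_ellFac_neg {a m q p : ℂ} (hp : ‖p‖ < 1) (ha0 : a ≠ 0) (hm0 : m ≠ 0)
    (hq0 : q ≠ 0) (hma : ∀ j : ℕ, modTheta (m / a / q ^ (j + 1)) p ≠ 0) (s : ℕ) :
    thetaFac p (a * q / m) q s * ellFac (m / a) q p (-(s : ℤ)) =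
      (-(a * q / m)) ^ s * q ^ s.choose 2 := by
  rw [ellFac_neg, ← prod_neg_mul_pow, ← div_eq_mul_inv, thetaFac,
    div_eq_iff (Finset.prod_ne_zero_iff.mpr fun j _ => hma j), ← Finset.prod_mul_distrib]
  refine Finset.prod_congr rfl fun j _ => ?_
  have hz : a * q / m * q ^ j ≠ 0 := by positivity
  rw [show m / a / q ^ (j + 1) = (a * q / m * q ^ j)⁻¹ by field_simp; ring, modTheta_inv hp hz]
  field_simp

/-! ### The kernel between A and β -/

section Kernel

variable {a k m q p : ℂ}

/-- The terms of the double sum obtained by inserting the bibasic relation into the definition of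
`β` are, up to a factor, the terms of a cubic sum. -/
lemma bibasic_term (ha0 : a ≠ 0) (hk0 : k ≠ 0) (hm0 : m ≠ 0) (hq0 : q ≠ 0)
    (ha : ∀ n, thetaFac p (a * q ^ 2) (q ^ 2) n ≠ 0)
    (hm : ∀ j : ℕ, modTheta (m * q ^ j) p ≠ 0) (hkm : ∀ n, thetaFac p (k / m) q n ≠ 0)
    (hm2a : ∀ n, thetaFac p (m ^ 2 * q / a) (q ^ 2) n ≠ 0) (E : ℂ) (s t d : ℕ) :
    modTheta (m * q ^ (3 * (s + t))) p / modTheta m p *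
      (thetaFac p (a * q / m) q (s + t) / thetaFac p (m ^ 2 * q / a) (q ^ 2) (s + t)) *
      (thetaFac p (m ^ 2 * q / k) (q ^ 2) (s + t) / thetaFac p (k / m) q (s + t)) *
      (thetaFac p (k / m) q (s + t + 2 * d) / thetaFac p (q ^ 2) (q ^ 2) d) *
      (thetaFac p k (q ^ 2) (2 * s + (t + d) + t) /
        thetaFac p (m * q) q (3 * s + t + 2 * (t + d))) *
      q ^ ((s + t).choose 2) * (k / m) ^ (s + t) *
      (E * thetaFac p (m / a / q ^ s) q t / thetaFac p (q ^ 2) (q ^ 2) t *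
        (thetaFac p m q (3 * s + t) / thetaFac p (a * q ^ 2) (q ^ 2) (2 * s + t))) =
    thetaFac p (a * q / m) q s / thetaFac p (m ^ 2 * q / a) (q ^ 2) s *
      thetaFac p (m ^ 2 * q / k) (q ^ 2) s * thetaFac p k (q ^ 2) (2 * s + (t + d)) * E /
      thetaFac p (a * q ^ 2) (q ^ 2) (2 * s) * (q ^ s.choose 2 * (k / m) ^ s) /
      (thetaFac p ((m * q ^ (3 * s)) ^ 2 * q / (a * q ^ (4 * s))) (q ^ 2) (t + d) *
        thetaFac p (a * q ^ (4 * s) * q ^ 2) (q ^ 2) (t + d)) *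
      (cubicCoeff p (k * q ^ (4 * s)) (m * q ^ (3 * s)) q t d *
        cubicBasis p (a * q ^ (4 * s)) (m * q ^ (3 * s)) q t d) := by
  have h1 : m * q ^ (3 * (s + t)) = m * q ^ (3 * s) * q ^ (3 * t) := by ring
  have h2 : thetaFac p (a * q / m) q (s + t) = thetaFac p (a * q / m) q s *
      thetaFac p (a * q ^ (4 * s) * q / (m * q ^ (3 * s))) q t := by
    rw [thetaFac_add]; congr 2; field_simp; ring
  have h3 (n : ℕ) : thetaFac p (m ^ 2 * q / a) (q ^ 2) (s + n) =
      thetaFac p (m ^ 2 * q / a) (q ^ 2) s *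
      thetaFac p ((m * q ^ (3 * s)) ^ 2 * q / (a * q ^ (4 * s))) (q ^ 2) n := by
    rw [thetaFac_add]; congr 2; field_simp; ring
  have n3 (n : ℕ) : thetaFac p ((m * q ^ (3 * s)) ^ 2 * q / (a * q ^ (4 * s))) (q ^ 2) n ≠ 0 := by
    have := hm2a (s + n)
    rw [h3] at this
    exact right_ne_zero_of_mul this
  have h4 : thetaFac p (m ^ 2 * q / k) (q ^ 2) (s + t) = thetaFac p (m ^ 2 * q / k) (q ^ 2) s *
      thetaFac p ((m * q ^ (3 * s)) ^ 2 * q / (k * q ^ (4 * s))) (q ^ 2) t := by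
    rw [thetaFac_add]; congr 2; field_simp; ring
  have h5 : thetaFac p (k / m) q (s + t + 2 * d) = thetaFac p (k / m) q (s + t) *
      thetaFac p (k * q ^ (4 * s) * q ^ t / (m * q ^ (3 * s))) q (2 * d) := by
    rw [thetaFac_add]; congr 2; field_simp; ring
  have h6 : thetaFac p k (q ^ 2) (2 * s + (t + d) + t) = thetaFac p k (q ^ 2) (2 * s + (t + d)) *
      thetaFac p (k * q ^ (4 * s) * q ^ (2 * (t + d))) (q ^ 2) t := by
    rw [thetaFac_add]; congr 2; ring
  have hm1 : modTheta m p ≠ 0 := by simpa using hm 0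
  have hmn (n : ℕ) : thetaFac p m q n ≠ 0 := thetaFac_ne_zero fun j _ => hm j
  have h7 : thetaFac p (m * q) q (3 * s + t + 2 * (t + d)) = thetaFac p m q (3 * s + t) *
      thetaFac p (m * q ^ (3 * s) * q ^ t) q (2 * (t + d) + 1) / modTheta m p := by
    rw [eq_div_iff hm1, mul_comm _ (modTheta m p), ← thetaFac_succ', add_assoc (3 * s + t),
      thetaFac_add p m, mul_assoc m, ← pow_add]
  have h8 : m / a / q ^ s = m * q ^ (3 * s) / (a * q ^ (4 * s)) := by
    field_simp; ring
  have h9 (n : ℕ) : thetaFac p (a * q ^ 2) (q ^ 2) (2 * s + n) =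
      thetaFac p (a * q ^ 2) (q ^ 2) (2 * s) * thetaFac p (a * q ^ (4 * s) * q ^ 2) (q ^ 2) n := by
    rw [thetaFac_add]; congr 2; ring
  have n9 (n : ℕ) : thetaFac p (a * q ^ (4 * s) * q ^ 2) (q ^ 2) n ≠ 0 := by
    have := ha (2 * s + n)
    rw [h9] at this
    exact right_ne_zero_of_mul this
  have h10 : q ^ ((s + t).choose 2) * (k / m) ^ (s + t) = q ^ (s.choose 2) * (k / m) ^ s *
      (q ^ (t.choose 2) * (k / m * q ^ s) ^ t) := by
    rw [choose_two_add]; ring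
  have h11 : k * q ^ (4 * s) / (m * q ^ (3 * s)) = k / m * q ^ s := by
    field_simp; ring
  have h12 : thetaFac p ((m * q ^ (3 * s)) ^ 2 * q ^ (2 * t + 1) / (a * q ^ (4 * s))) (q ^ 2) d =
      thetaFac p ((m * q ^ (3 * s)) ^ 2 * q / (a * q ^ (4 * s))) (q ^ 2) (t + d) /
        thetaFac p ((m * q ^ (3 * s)) ^ 2 * q / (a * q ^ (4 * s))) (q ^ 2) t := by
    rw [thetaFac_add, mul_div_cancel_left₀ _ (n3 t)]; congr 1; ring
  have h13 : thetaFac p (a * q ^ (4 * s) * q ^ (2 * t + 2)) (q ^ 2) d =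
      thetaFac p (a * q ^ (4 * s) * q ^ 2) (q ^ 2) (t + d) /
        thetaFac p (a * q ^ (4 * s) * q ^ 2) (q ^ 2) t := by
    rw [thetaFac_add, mul_div_cancel_left₀ _ (n9 t)]; congr 1; ring
  simp only [cubicCoeff, cubicBasis]
  rw [mul_assoc _ (q ^ ((s + t).choose 2)), h10, h1, h2, h3, h4, h5, h6, h7, h8, h9, h11, h12, h13]
  have aux : ∀ {θm w μ B3 D3 : ℂ} (T1 a1 a2 b1 b2 c1 c2 w2 Qd K1 K2 Z q1 q2 κ2 E a3 Qt d1 d2 : ℂ),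
      θm ≠ 0 → w ≠ 0 → μ ≠ 0 → B3 ≠ 0 → D3 ≠ 0 →
      T1 / θm * (a1 * a2 / (b1 * b2)) * (c1 * c2 / w) * (w * w2 / Qd) * (K1 * K2 / (μ * Z / θm)) *
        (q1 * (q2 * κ2)) * (E * a3 / Qt * (μ / (d1 * d2))) =
      a1 / b1 * c1 * K1 * E / d1 * q1 / (B3 * D3) *
        (T1 * c2 * w2 * K2 * q2 * κ2 / (Qd * Qt * Z) * (a2 * a3 * (B3 / b2 * (D3 / d2)))) := by
    intro θm w μ B3 D3 T1 a1 a2 b1 b2 c1 c2 w2 Qd K1 K2 Z q1 q2 κ2 E a3 Qt d1 d2 hθ hw hμ hB hD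
    trans T1 * a1 * a2 * c1 * c2 * w2 * K1 * K2 * q1 * q2 * κ2 * E * a3 * b1⁻¹ * b2⁻¹ * Qd⁻¹ *
      Z⁻¹ * Qt⁻¹ * d1⁻¹ * d2⁻¹
    · rw [← mul_one (_ * d2⁻¹), ← mul_inv_cancel₀ (mul_ne_zero (mul_ne_zero hθ hw) hμ)]
      simp only [div_eq_mul_inv, mul_inv, inv_inv]
      ring
    · rw [← mul_one (_ * d2⁻¹), ← mul_inv_cancel₀ (mul_ne_zero hB hD)]
      ring
  exact aux _ _ _ _ _ _ _ _ _ _ _ _ _ _ _ _ _ _ _ _ hm1 (hkm _) (hmn _) (n3 _) (n9 _)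

end Kernel

section Kernel

variable {a k m q p : ℂ}

/-- The kernel of the relation between `A` and `β` in closed form. -/
lemma bibasic_sum (hp : ‖p‖ < 1) (ha0 : a ≠ 0) (hk0 : k ≠ 0) (hm0 : m ≠ 0) (hq0 : q ≠ 0)
    (hq : ∀ j : ℕ, modTheta (q ^ (2 * (j + 1))) p ≠ 0)
    (ha : ∀ n, thetaFac p (a * q ^ 2) (q ^ 2) n ≠ 0)
    (hm : ∀ j : ℕ, modTheta (m * q ^ j) p ≠ 0)
    (hma : ∀ j : ℕ, modTheta (m / a / q ^ (j + 1)) p ≠ 0)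
    (hkm : ∀ n, thetaFac p (k / m) q n ≠ 0)
    (hakm : ∀ n, thetaFac p (a * k * q / m ^ 2) (q ^ 2) n ≠ 0)
    (hm2a : ∀ n, thetaFac p (m ^ 2 * q / a) (q ^ 2) n ≠ 0) (s N : ℕ) :
    thetaFac p (m ^ 2 * q / a) (q ^ 2) (s + N) / thetaFac p (a * k * q / m ^ 2) (q ^ 2) (s + N) *
      ∑ t ∈ Finset.range (N + 1),
        modTheta (m * q ^ (3 * (s + t))) p / modTheta m p *
        (thetaFac p (a * q / m) q (s + t) / thetaFac p (m ^ 2 * q / a) (q ^ 2) (s + t)) *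
        (thetaFac p (m ^ 2 * q / k) (q ^ 2) (s + t) / thetaFac p (k / m) q (s + t)) *
        (thetaFac p (k / m) q (s + t + 2 * (N - t)) / thetaFac p (q ^ 2) (q ^ 2) (N - t)) *
        (thetaFac p k (q ^ 2) (2 * s + N + t) / thetaFac p (m * q) q (3 * s + t + 2 * N)) *
        q ^ ((s + t).choose 2) * (k / m) ^ (s + t) *
        (ellFac (m / a) q p ((t : ℤ) - s) / thetaFac p (q ^ 2) (q ^ 2) t *
          (thetaFac p m q (3 * s + t) / thetaFac p (a * q ^ 2) (q ^ 2) (2 * s + t))) =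
    thetaFac p (k / a) (q ^ 2) N / thetaFac p (q ^ 2) (q ^ 2) N *
      (thetaFac p k (q ^ 2) (2 * s + N) / thetaFac p (a * q ^ 2) (q ^ 2) (2 * s + N)) *
      (thetaFac p (m ^ 2 * q / k) (q ^ 2) s / thetaFac p (a * k * q / m ^ 2) (q ^ 2) s *
        q ^ (s ^ 2) * (-(a * k / m ^ 2)) ^ s) := by
  have hsum := cubicSum hp (a := a * q ^ (4 * s)) (k := k * q ^ (4 * s)) (m := m * q ^ (3 * s))
    (by positivity) (by positivity) (by positivity) hq0 hq
    (fun j => by rw [mul_assoc, ← pow_add]; exact hm _) N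
  rw [CubicSum] at hsum
  -- G collects everything independent of t, including (m/a; q)_{-s}, which `ellFac_sub` splits off
  -- from (m/a; q)_{t-s}.
  set G := thetaFac p (a * q / m) q s / thetaFac p (m ^ 2 * q / a) (q ^ 2) s *
      thetaFac p (m ^ 2 * q / k) (q ^ 2) s * thetaFac p k (q ^ 2) (2 * s + N) *
      ellFac (m / a) q p (-(s : ℤ)) / thetaFac p (a * q ^ 2) (q ^ 2) (2 * s) *
      (q ^ s.choose 2 * (k / m) ^ s) /
      (thetaFac p ((m * q ^ (3 * s)) ^ 2 * q / (a * q ^ (4 * s))) (q ^ 2) N *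
        thetaFac p (a * q ^ (4 * s) * q ^ 2) (q ^ 2) N) with hG
  rw [Finset.sum_congr rfl (g := fun t => G * (cubicCoeff p (k * q ^ (4 * s)) (m * q ^ (3 * s)) q t
      (N - t) * cubicBasis p (a * q ^ (4 * s)) (m * q ^ (3 * s)) q t (N - t))) (fun t ht => by
    obtain ⟨d, rfl⟩ := Nat.exists_eq_add_of_le (Nat.lt_succ_iff.mp (Finset.mem_range.mp ht))
    rw [show t + d - t = d by omega, ellFac_sub hq0 hma]
    exact bibasic_term ha0 hk0 hm0 hq0 ha hm hkm hm2a _ s t d), ← Finset.mul_sum, hsum, hG]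
  have g1 : thetaFac p (m ^ 2 * q / a) (q ^ 2) (s + N) = thetaFac p (m ^ 2 * q / a) (q ^ 2) s *
      thetaFac p ((m * q ^ (3 * s)) ^ 2 * q / (a * q ^ (4 * s))) (q ^ 2) N := by
    rw [thetaFac_add]; congr 2; field_simp; ring
  have g2 : thetaFac p (a * k * q / m ^ 2) (q ^ 2) (s + N) =
      thetaFac p (a * k * q / m ^ 2) (q ^ 2) s *
      thetaFac p (a * q ^ (4 * s) * (k * q ^ (4 * s)) * q / (m * q ^ (3 * s)) ^ 2) (q ^ 2) N := by
    rw [thetaFac_add]; congr 2; field_simp; ring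
  have g3 : thetaFac p (a * q ^ 2) (q ^ 2) (2 * s + N) = thetaFac p (a * q ^ 2) (q ^ 2) (2 * s) *
      thetaFac p (a * q ^ (4 * s) * q ^ 2) (q ^ 2) N := by
    rw [thetaFac_add]; congr 2; ring
  -- The two binomial powers of q, together with q^s, combine to q^{s²}.
  have g4 : thetaFac p (a * q / m) q s * ellFac (m / a) q p (-(s : ℤ)) *
      (q ^ s.choose 2 * (k / m) ^ s) = q ^ (s ^ 2) * (-(a * k / m ^ 2)) ^ s := by
    rw [thetaFac_mul_ellFac_neg hp ha0 hm0 hq0 hma, sq s, ← add_two_mul_choose_two, pow_add,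
      pow_mul, show -(a * q / m) = q * (-(a / m)) by ring,
      show -(a * k / m ^ 2) = -(a / m) * (k / m) by field_simp, mul_pow, mul_pow]
    ring
  have n1 := hm2a (s + N)
  rw [g1] at n1
  have n2 := hakm (s + N)
  rw [g2] at n2
  rw [g1, g2, g3, mul_div_mul_right k a (pow_ne_zero _ hq0), mul_assoc (_ / _) (q ^ (s ^ 2)), ← g4]
  have aux : ∀ {b1 B3 e1 e2 : ℂ} (a1 c1 K1 E d1 q1 D3 Q f : ℂ), b1 * B3 ≠ 0 → e1 * e2 ≠ 0 →
      b1 * B3 / (e1 * e2) * (a1 / b1 * c1 * K1 * E / d1 * q1 / (B3 * D3) * (Q⁻¹ * (e2 * f))) =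
      f / Q * (K1 / (d1 * D3)) * (c1 / e1 * (a1 * E * q1)) := by
    intro b1 B3 e1 e2 a1 c1 K1 E d1 q1 D3 Q f h1 h2
    trans f * K1 * c1 * a1 * E * q1 * Q⁻¹ * d1⁻¹ * D3⁻¹ * e1⁻¹
    · rw [← mul_one (_ * e1⁻¹), ← mul_inv_cancel₀ h1,
        ← mul_one (_ * (_ * (b1 * B3)⁻¹)), ← mul_inv_cancel₀ (right_ne_zero_of_mul h2)]
      simp only [div_eq_mul_inv, mul_inv]
      ring
    · simp only [div_eq_mul_inv, mul_inv]
      ring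
  exact aux _ _ _ _ _ _ _ _ _ n1 n2

end Kernel

/-! ### The theorem -/

theorem theorem5p3 (a k m q p : ℂ) (hp : ‖p‖ < 1)
    (ha0 : a ≠ 0) (hk0 : k ≠ 0) (hm0 : m ≠ 0) (hq0 : q ≠ 0)
    (hq : ∀ j : ℕ, modTheta (q ^ (2 * (j + 1))) p ≠ 0)
    (ha : ∀ j : ℕ, modTheta (a * q ^ (2 * j)) p ≠ 0)
    (hk : ∀ j : ℕ, modTheta (k * q ^ (2 * j)) p ≠ 0)
    (hm : ∀ j : ℕ, modTheta (m * q ^ j) p ≠ 0)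
    (hma : ∀ j : ℕ, modTheta (m / a / q ^ (j + 1)) p ≠ 0)
    (hkm : ∀ j : ℕ, modTheta (k / m * q ^ j) p ≠ 0)
    (hakm : ∀ j : ℕ, modTheta (a * k * q / m ^ 2 * q ^ (2 * j)) p ≠ 0)
    (hm2a : ∀ j : ℕ, modTheta (m ^ 2 * q / a * q ^ (2 * j)) p ≠ 0)
    (A B α β : ℕ → ℂ)
    (hAB : IsBibasicEllipticWPBaileyPair 2 a m q p A B)
    (hα : ∀ n : ℕ, α n =
      ellFac (m ^ 2 * q / k) (q ^ 2) p n / ellFac (a * k * q / m ^ 2) (q ^ 2) p n *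
        q ^ (n ^ 2) * (-(a * k / m ^ 2)) ^ n * A n)
    (hβ : ∀ n : ℕ, β n =
      ellFac (m ^ 2 * q / a) (q ^ 2) p n / ellFac (a * k * q / m ^ 2) (q ^ 2) p n *
        ∑ r ∈ Finset.range (n + 1),
          modTheta (m * q ^ (3 * r)) p / modTheta m p *
            (ellFac (a * q / m) q p r / ellFac (m ^ 2 * q / a) (q ^ 2) p r) *
            (ellFac (m ^ 2 * q / k) (q ^ 2) p r / ellFac (k / m) q p r) *
            (ellFac (k / m) q p (2 * (n : ℤ) - r) / ellFac (q ^ 2) (q ^ 2) p ((n : ℤ) - r)) *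
            (ellFac k (q ^ 2) p ((n : ℤ) + r) / ellFac (m * q) q p (2 * (n : ℤ) + r)) *
            q ^ (r.choose 2) * (k / m) ^ r * B r) :
    IsEllipticWPBaileyPair a k (q ^ 2) p α β := by
  have ha' (n : ℕ) : thetaFac p (a * q ^ 2) (q ^ 2) n ≠ 0 := thetaFac_ne_zero fun j _ => by
    have := ha (j + 1)
    rwa [show a * q ^ (2 * (j + 1)) = a * q ^ 2 * (q ^ 2) ^ j by ring] at this
  have hkm' (n : ℕ) : thetaFac p (k / m) q n ≠ 0 := thetaFac_ne_zero fun j _ => hkm j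
  have hakm' (n : ℕ) : thetaFac p (a * k * q / m ^ 2) (q ^ 2) n ≠ 0 :=
    thetaFac_ne_zero fun j _ => by rw [← pow_mul]; exact hakm j
  have hm2a' (n : ℕ) : thetaFac p (m ^ 2 * q / a) (q ^ 2) n ≠ 0 :=
    thetaFac_ne_zero fun j _ => by rw [← pow_mul]; exact hm2a j
  have hsub {n r : ℕ} (h : r ≤ n) : (n : ℤ) - r = ((n - r : ℕ) : ℤ) := (Nat.cast_sub h).symm
  have hadd (n r : ℕ) : (n : ℤ) + r = ((n + r : ℕ) : ℤ) := (Nat.cast_add n r).symm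
  have hmain (n : ℕ) : β n = ∑ r ∈ Finset.range (n + 1),
      thetaFac p (k / a) (q ^ 2) (n - r) / thetaFac p (q ^ 2) (q ^ 2) (n - r) *
        (thetaFac p k (q ^ 2) (n + r) / thetaFac p (a * q ^ 2) (q ^ 2) (n + r)) * α r := by
    rw [hβ]
    simp only [hAB _, Finset.mul_sum]
    -- After the interchange, s indexes `A` and r = s + t indexes `B`.
    rw [sum_range_triangle (fun r s => _ * (_ * (_ * A s)))]
    refine Finset.sum_congr rfl fun s hs => ?_
    obtain ⟨N, rfl⟩ := Nat.exists_eq_add_of_le (Nat.lt_succ_iff.mp (Finset.mem_range.mp hs))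
    rw [hα, show s + N - s = N by omega, show s + N + s = 2 * s + N by ring, ellFac_natCast,
      ellFac_natCast, ellFac_natCast _ _ _ s, ellFac_natCast _ _ _ s, ← mul_assoc _ _ (A s),
      ← bibasic_sum hp ha0 hk0 hm0 hq0 hq ha' hm hma
      hkm' hakm' hm2a', Finset.mul_sum, Finset.sum_mul]
    refine Finset.sum_congr rfl fun t ht => ?_
    obtain ⟨d, rfl⟩ := Nat.exists_eq_add_of_le (Nat.lt_succ_iff.mp (Finset.mem_range.mp ht))
    have c1 : 2 * ((s + (t + d) : ℕ) : ℤ) - (s + t : ℕ) = (s + t + 2 * d : ℕ) := by push_cast; ring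
    have c2 : ((s + (t + d) : ℕ) : ℤ) - (s + t : ℕ) = d := by push_cast; ring
    have c3 : ((s + (t + d) : ℕ) : ℤ) + (s + t : ℕ) = (2 * s + (t + d) + t : ℕ) := by
      push_cast; ring
    have c4 : 2 * ((s + (t + d) : ℕ) : ℤ) + (s + t : ℕ) = (3 * s + t + 2 * (t + d) : ℕ) := by
      push_cast; ring
    -- This is the only index that can be negative; all others become natural numbers.
    have c5 : ((s + t : ℕ) : ℤ) - (2 : ℕ) * s = t - s := by push_cast; ring
    have c6 : ((s + t : ℕ) : ℤ) - s = t := by push_cast; ring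
    have c7 : ((s + t : ℕ) : ℤ) + (2 : ℕ) * s = (3 * s + t : ℕ) := by push_cast; ring
    have c8 : ((s + t : ℕ) : ℤ) + s = (2 * s + t : ℕ) := by push_cast; ring
    rw [c1, c2, c3, c4, c5, c6, c7, c8, show t + d - t = d by omega]
    simp only [ellFac_natCast]
    ring_nf
  refine ⟨fun n => ?_, fun n => ?_⟩
  · rw [hmain]
    refine Finset.sum_congr rfl fun r hr => ?_
    rw [hsub (Nat.lt_succ_iff.mp (Finset.mem_range.mp hr)), hadd]
    simp only [ellFac_natCast]
  · rw [bailey_inversion hp ha0 hk0 (pow_ne_zero 2 hq0) (fun j => by rw [← pow_mul]; exact hq j)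
      (fun j => by rw [← pow_mul]; exact ha j) (fun j => by rw [← pow_mul]; exact hk j) α β hmain n]
    congr 1
    refine Finset.sum_congr rfl fun r hr => ?_
    rw [hsub (Nat.lt_succ_iff.mp (Finset.mem_range.mp hr)), hadd]
    simp only [ellFac_natCast]
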